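/- **Theorem.** Let $d$ be a non-negative integer, let $B_d$ be the open unit ball of $\mathbb{C}^d$, and let $H_d^2$ be the Hilbert space of holomorphic functions on $B_d$ with reproducing kernel $k(z,w)=\frac{1}{1-\langle z,w\rangle}$. For $1\le i\le d$ let $S_i$ be the bounded operator on $H_d^2$ of multiplication by the $i$-th coordinate function, $(S_i\xi)(z)=z_i\,\xi(z)$. For $k\in\mathbb{Z}$ put $E_k=H_d^2\otimes\bigwedge^k\mathbb{C}^d$ (zero unless $0\le k\le d$), put $E=\bigoplus_k E_k$, and let $\partial:E\to E$ be the Koszul boundary operator, with restrictions $\partial_k:E_k\to E_{k-1}$ given by $$\partial_k(\xi\otimes e_{i_1}\wedge\cdots\wedge e_{i_k})=\sum_{j=1}^k(-1)^{j+1}S_{i_j}\xi\otimes e_{i_1}\wedge\cdots\wedge\widehat{e_{i_j}}\wedge\cdots\wedge e_{i_k},$$ where $e_1,\dots,e_d$ is the standard basis of $\mathbb{C}^d$ and the $e_{i_1}\wedge\cdots\wedge e_{i_k}$, $i_1<\cdots<i_k$, are orthonormal. Then: 1. The $d$-tuple $(S_1,\dots,S_d)$ is Fredholm, that is, the $S_i$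 commute with each other and the Dirac operator $\partial+\partial^*$ on $E$ is a Fredholm operator. 2. The augmented Koszul complex $$\cdots\xrightarrow{\partial_2}E_1\xrightarrow{\partial_1}E_0\xrightarrow{\partial_{1/2}}\mathbb{C}\to 0$$ is exact, where $\partial_{1/2}:E_0=H_d^2\to\mathbb{C}$ is the evaluation $\xi\mapsto\xi(0)$. 3. Consequently $\ker\partial_k/\operatorname{im}\partial_{k+1}=0$ for all $k\ge 1$, and $\ker\partial_0/\operatorname{im}\partial_1\cong\mathbb{C}$. -/

import Mathlib

open scoped ComplexConjugate

noncomputable section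

namespace DShift

/-! ### The space `H_d^2` -/

/-- The open unit ball `B_d` of `ℂ^d`. -/
abbrev Ball (d : ℕ) : Type := Metric.ball (0 : EuclideanSpace ℂ (Fin d)) 1

/-- The origin of `B_d`. -/
def origin (d : ℕ) : Ball d := ⟨0, Metric.mem_ball_self one_pos⟩

/-- The scalar kernel `k(z, w) = 1 / (1 - ⟨z, w⟩)` on `B_d`, where `⟨z, w⟩ = ∑ z_i * conj w_i`
(Mathlib's inner product is linear in its second argument, so this is `inner ℂ w z`). -/
def scalarKernel {d : ℕ} (z w : Ball d) : ℂ := 1 / (1 - inner ℂ (w : EuclideanSpace ℂ (Fin d)) z)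

/-- The kernel `scalarKernel`, regarded as an operator-valued kernel on the
one-dimensional space `ℂ`. -/
def kernel (d : ℕ) : Matrix (Ball d) (Ball d) (ℂ →L[ℂ] ℂ) :=
  Matrix.of fun z w => scalarKernel z w • ContinuousLinearMap.id ℂ ℂ

lemma norm_inner_lt {d : ℕ} (z w : Ball d) :
    ‖inner ℂ (w : EuclideanSpace ℂ (Fin d)) (z : EuclideanSpace ℂ (Fin d))‖ < 1 := by
  have hz : ‖(z : EuclideanSpace ℂ (Fin d))‖ < 1 := mem_ball_zero_iff.mp z.2
  have hw : ‖(w : EuclideanSpace ℂ (Fin d))‖ < 1 := mem_ball_zero_iff.mp w.2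
  calc _ ≤ ‖(w : EuclideanSpace ℂ (Fin d))‖ * ‖(z : EuclideanSpace ℂ (Fin d))‖ :=
        norm_inner_le_norm _ _
    _ < 1 := by nlinarith [norm_nonneg (z : EuclideanSpace ℂ (Fin d)),
        norm_nonneg (w : EuclideanSpace ℂ (Fin d))]

lemma inner_eq {d : ℕ} (z w : Ball d) :
    inner ℂ (w : EuclideanSpace ℂ (Fin d)) (z : EuclideanSpace ℂ (Fin d)) =
      ∑ i, z.1 i * conj (w.1 i) := by
  simp [PiLp.inner_apply]

lemma conj_scalarKernel {d : ℕ} (z w : Ball d) : conj (scalarKernel z w) = scalarKernel w z := by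
  simp [scalarKernel]

lemma scalarKernel_eq {d : ℕ} (z w : Ball d) :
    scalarKernel z w = 1 + ∑ i, z.1 i * conj (w.1 i) * scalarKernel z w := by
  have h : (1 - inner ℂ (w : EuclideanSpace ℂ (Fin d)) (z : EuclideanSpace ℂ (Fin d))) ≠ 0 := by
    intro h
    have := norm_inner_lt z w
    rw [← sub_eq_zero.mp h] at this
    simp at this
  rw [← Finset.sum_mul, ← inner_eq, scalarKernel]
  field_simp
  ring

lemma hasSum_scalarKernel {d : ℕ} (z w : Ball d) :
    HasSum (fun n => ∑ p : Fin n → Fin d, (∏ m, z.1 (p m)) * conj (∏ m, w.1 (p m)))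
      (scalarKernel z w) := by
  have := hasSum_geometric_of_norm_lt_one (norm_inner_lt z w)
  simp only [inner_eq z w, Fintype.sum_pow, Finset.prod_mul_distrib, ← map_prod] at this
  simpa [scalarKernel, inner_eq z w] using this

/-- The kernel is positive semidefinite. -/
lemma posSemidef_kernel (d : ℕ) : (kernel d).PosSemidef := by
  have h := (RKHS.posSemidef_tfae (K := kernel d)).out 0 2
  refine h.mpr ⟨?_, fun v => ?_⟩
  · ext z w
    refine ext_inner_right ℂ fun w' => ?_
    have h1 : ContinuousLinearMap.adjoint (ContinuousLinearMap.id ℂ ℂ) =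
        ContinuousLinearMap.id ℂ ℂ := ContinuousLinearMap.adjoint_id
    simp [kernel, Matrix.conjTranspose_apply, ContinuousLinearMap.star_eq_adjoint, conj_scalarKernel, h1]
  · simp only [Finsupp.sum]
    have key : HasSum (fun n => ∑ x ∈ v.support, ∑ y ∈ v.support,
        (v y * conj (v x)) * conj (∑ p : Fin n → Fin d,
          (∏ m, y.1 (p m)) * conj (∏ m, x.1 (p m))))
        (∑ x ∈ v.support, ∑ y ∈ v.support, (v y * conj (v x)) * conj (scalarKernel y x)) :=
      hasSum_sum fun x _ => hasSum_sum fun y _ =>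
        ((Complex.hasSum_conj'.mpr (hasSum_scalarKernel y x)).mul_left _)
    have e : (∑ x ∈ v.support, ∑ y ∈ v.support, (v y * conj (v x)) * conj (scalarKernel y x)) =
        ∑ x ∈ v.support, ∑ y ∈ v.support, inner ℂ ((kernel d) y x (v x)) (v y) := by
      refine Finset.sum_congr rfl fun x _ => Finset.sum_congr rfl fun y _ => ?_
      simp [kernel]
      ring
    rw [← e]
    refine (Complex.hasSum_re key).nonneg fun n => ?_
    have e2 : (∑ x ∈ v.support, ∑ y ∈ v.support,
        (v y * conj (v x)) * conj (∑ p : Fin n → Fin d,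
          (∏ m, y.1 (p m)) * conj (∏ m, x.1 (p m)))) =
        ∑ p : Fin n → Fin d, conj (∑ y ∈ v.support, conj (v y) * ∏ m, y.1 (p m)) *
          (∑ y ∈ v.support, conj (v y) * ∏ m, y.1 (p m)) := by
      simp only [map_sum, map_mul, Finset.mul_sum, Complex.conj_conj]
      rw [Finset.sum_comm (s := Finset.univ)]
      refine Finset.sum_congr rfl fun x _ => ?_
      rw [Finset.sum_comm]
      refine Finset.sum_congr rfl fun p _ => ?_
      rw [Finset.sum_mul]
      refine Finset.sum_congr rfl fun y _ => ?_
      ring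
    rw [e2]
    simp only [Complex.re_sum]
    refine Finset.sum_nonneg fun p _ => ?_
    rw [← Complex.normSq_eq_conj_mul_self]
    simpa using Complex.normSq_nonneg _

instance (d : ℕ) : Fact (kernel d).PosSemidef := ⟨posSemidef_kernel d⟩

/-- `H_d^2`: the Hilbert space of (automatically holomorphic) functions on `B_d` with reproducing kernel
`1 / (1 - ⟨z, w⟩)`. -/
def H2 (d : ℕ) : Type := RKHS.OfKernel (kernel d)

instance (d : ℕ) : NormedAddCommGroup (H2 d) :=
  inferInstanceAs (NormedAddCommGroup (RKHS.OfKernel (kernel d)))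

instance (d : ℕ) : InnerProductSpace ℂ (H2 d) :=
  inferInstanceAs (InnerProductSpace ℂ (RKHS.OfKernel (kernel d)))

instance (d : ℕ) : CompleteSpace (H2 d) :=
  inferInstanceAs (CompleteSpace (RKHS.OfKernel (kernel d)))

instance (d : ℕ) : RKHS ℂ (H2 d) (Ball d) ℂ :=
  inferInstanceAs (RKHS ℂ (RKHS.OfKernel (kernel d)) (Ball d) ℂ)

lemma kernel_H2 (d : ℕ) : RKHS.kernel (H2 d) = kernel d :=
  RKHS.OfKernel.kernel_ofKernel (K := kernel d)

/-- The kernel function of `H_d^2` at `w` is `z ↦ 1 / (1 - ⟨z, w⟩)`. -/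
lemma kerFun_apply {d : ℕ} (z w : Ball d) : RKHS.kerFun (H2 d) w 1 z = scalarKernel z w := by
  rw [RKHS.kerFun_apply, kernel_H2]
  simp [kernel]

/-- Evaluation at a point of `B_d`, a bounded functional on `H_d^2`. -/
def evalAt {d : ℕ} (z : Ball d) : H2 d →L[ℂ] ℂ :=
  (ContinuousLinearMap.proj z).comp (RKHS.coeCLM (H := H2 d) ℂ)

@[simp] lemma evalAt_apply {d : ℕ} (z : Ball d) (f : H2 d) : evalAt z f = f z := rfl


/-! ### The `d`-shift -/

/-- The linear combinations of kernel functions. -/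
def kerComb (d : ℕ) : (Ball d →₀ ℂ) →ₗ[ℂ] H2 d :=
  Finsupp.linearCombination ℂ fun w => RKHS.kerFun (H2 d) w 1

/-- The linear map determined by `k_w ↦ conj (w_i) k_w` on formal combinations. -/
def scale {d : ℕ} (i : Fin d) : (Ball d →₀ ℂ) →ₗ[ℂ] (Ball d →₀ ℂ) :=
  Finsupp.lsum ℂ fun w => conj (w.1 i) • Finsupp.lsingle w

lemma scale_apply {d : ℕ} (i : Fin d) (f : Ball d →₀ ℂ) (w : Ball d) :
    scale i f w = conj (w.1 i) * f w := by
  classical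
  simp +contextual [scale, Finsupp.lsum_apply, Finsupp.sum, Finsupp.single_apply]

lemma inner_kerComb {d : ℕ} (f : Ball d →₀ ℂ) (s : Finset (Ball d)) (hs : f.support ⊆ s) :
    inner ℂ (kerComb d f) (kerComb d f) = ∑ x ∈ s, ∑ y ∈ s, conj (f x) * f y * scalarKernel x y := by
  have e : kerComb d f = ∑ w ∈ s, f w • RKHS.kerFun (H2 d) w 1 := by
    rw [kerComb, Finsupp.linearCombination_apply, Finsupp.sum_of_support_subset _ hs _ (by simp)]
  rw [e, sum_inner]
  refine Finset.sum_congr rfl fun x _ => ?_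
  rw [inner_sum]
  refine Finset.sum_congr rfl fun y _ => ?_
  rw [inner_smul_left, inner_smul_right, RKHS.kerFun_inner, kerFun_apply]
  simp
  ring

lemma norm_kerComb_scale_le {d : ℕ} (i : Fin d) (f : Ball d →₀ ℂ) :
    ‖kerComb d (scale i f)‖ ≤ 1 * ‖kerComb d f‖ := by
  have hsub (j : Fin d) : (scale j f).support ⊆ f.support := by
    intro w hw
    simp only [Finsupp.mem_support_iff, scale_apply] at hw ⊢
    exact right_ne_zero_of_mul hw
  have key : inner ℂ (kerComb d f) (kerComb d f) =
      conj (∑ x ∈ f.support, f x) * (∑ x ∈ f.support, f x) +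
        ∑ j, inner ℂ (kerComb d (scale j f)) (kerComb d (scale j f)) := by
    rw [inner_kerComb f _ subset_rfl, map_sum, Finset.sum_mul_sum]
    simp only [inner_kerComb _ _ (hsub _), scale_apply]
    rw [Finset.sum_comm (s := Finset.univ), ← Finset.sum_add_distrib]
    refine Finset.sum_congr rfl fun x _ => ?_
    rw [Finset.sum_comm (s := Finset.univ), ← Finset.sum_add_distrib]
    refine Finset.sum_congr rfl fun y _ => ?_
    rw [scalarKernel_eq x y, mul_add, mul_one, Finset.mul_sum]
    congr 1
    refine Finset.sum_congr rfl fun j _ => ?_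
    rw [← scalarKernel_eq x y]
    simp
    ring
  rw [one_mul]
  have hre := congrArg Complex.re key
  rw [← Complex.normSq_eq_conj_mul_self, Complex.add_re, Complex.ofReal_re, Complex.re_sum] at hre
  have hn (g : H2 d) : (inner ℂ g g : ℂ).re = ‖g‖ ^ 2 := inner_self_eq_norm_sq (𝕜 := ℂ) g
  simp only [hn] at hre
  have h1 : ‖kerComb d (scale i f)‖ ^ 2 ≤ ∑ j, ‖kerComb d (scale j f)‖ ^ 2 :=
    Finset.single_le_sum (f := fun j => ‖kerComb d (scale j f)‖ ^ 2)
      (fun j _ => sq_nonneg _) (Finset.mem_univ i)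
  refine (sq_le_sq₀ (norm_nonneg _) (norm_nonneg _)).mp ?_
  linarith [Complex.normSq_nonneg (∑ x ∈ f.support, f x)]

lemma denseRange_kerComb (d : ℕ) : DenseRange (kerComb d) := by
  have h := RKHS.kerFun_dense (H2 d)
  have hle : Submodule.span ℂ {x | ∃ w v, RKHS.kerFun (H2 d) w v = x} ≤
      LinearMap.range (kerComb d) := by
    rw [Submodule.span_le]
    rintro _ ⟨w, v, rfl⟩
    refine ⟨Finsupp.single w v, ?_⟩
    rw [kerComb, Finsupp.linearCombination_single, ← map_smul, smul_eq_mul, mul_one]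
  rw [DenseRange, ← LinearMap.coe_range, Submodule.dense_iff_topologicalClosure_eq_top, eq_top_iff,
    ← h]
  exact Submodule.topologicalClosure_mono hle

/-- Multiplication by a coordinate function is a bounded operator on `H_d^2`. -/
theorem exists_mul_coord {d : ℕ} (i : Fin d) :
    ∃ S : H2 d →L[ℂ] H2 d, ∀ (f : H2 d) (z : Ball d), S f z = z.1 i * f z := by
  let T : H2 d →L[ℂ] H2 d := ((kerComb d).comp (scale i)).extendOfNorm (kerComb d)
  have hT (w : Ball d) : T (RKHS.kerFun (H2 d) w 1) = conj (w.1 i) • RKHS.kerFun (H2 d) w 1 := by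
    have := LinearMap.extendOfNorm_eq (f := (kerComb d).comp (scale i)) (denseRange_kerComb d)
      ⟨1, norm_kerComb_scale_le i⟩ (Finsupp.single w 1)
    have h1 : kerComb d (Finsupp.single w 1) = RKHS.kerFun (H2 d) w 1 := by simp [kerComb]
    have h2 : scale i (Finsupp.single w 1) = conj (w.1 i) • Finsupp.single w 1 := by simp [scale]
    rw [LinearMap.comp_apply, h2, map_smul, h1] at this
    exact this
  refine ⟨ContinuousLinearMap.adjoint T, fun f z => ?_⟩
  have h := RKHS.kerFun_inner z 1 (ContinuousLinearMap.adjoint T f)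
  rw [ContinuousLinearMap.adjoint_inner_right, hT, inner_smul_left, RKHS.kerFun_inner] at h
  simpa using h.symm

/-- The `d`-shift `(S_1, …, S_d)`: `S_i` is multiplication by the `i`-th coordinate function. -/
def shift (d : ℕ) (i : Fin d) : H2 d →L[ℂ] H2 d := (exists_mul_coord i).choose

theorem shift_apply {d : ℕ} (i : Fin d) (f : H2 d) (z : Ball d) :
    shift d i f z = z.1 i * f z :=
  (exists_mul_coord i).choose_spec f z

/-! ### The Koszul complex of a tuple of operators on a Hilbert space -/

variable {d : ℕ} {H : Type*} [NormedAddCommGroup H] [InnerProductSpace ℂ H]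

/-- The Hilbert space `H ⊗ ⋀ ℂ^d`. The vectors `e_s = e_{i_1} ∧ ⋯ ∧ e_{i_k}`, for
`s = {i_1 < ⋯ < i_k}`, form an orthonormal basis of `⋀ ℂ^d`, and `∑ s, ξ_s ⊗ e_s` is
represented by its coordinate family `(ξ_s)`. -/
abbrev Koszul (d : ℕ) (H : Type*) : Type _ := PiLp 2 fun _ : Finset (Fin d) => H

/-- The elementary tensor `ξ ⊗ e_s`. -/
def tensor (ξ : H) (s : Finset (Fin d)) : Koszul d H := PiLp.single 2 s ξ

/-- The sign `(-1) ^ (j + 1)`, where `i` is the `j`-th smallest element of `insert i s`. -/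
def sign (i : Fin d) (s : Finset (Fin d)) : ℂ := (-1) ^ (s.filter (· < i)).card

/-- The boundary operator `∂ = ∑ T_i ⊗ c_i^*` on `H ⊗ ⋀ ℂ^d`; `boundary_tensor` gives its
values on elementary tensors. -/
def boundary (T : Fin d → H →L[ℂ] H) : Koszul d H →L[ℂ] Koszul d H :=
  (PiLp.continuousLinearEquiv 2 ℂ fun _ : Finset (Fin d) => H).symm.toContinuousLinearMap.comp
    (ContinuousLinearMap.pi fun t =>
      ∑ i ∈ tᶜ, sign i t • (T i).comp (PiLp.proj 2 (fun _ : Finset (Fin d) => H) (insert i t)))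

lemma boundary_apply (T : Fin d → H →L[ℂ] H) (ξ : Koszul d H) (t : Finset (Fin d)) :
    boundary T ξ t = ∑ i ∈ tᶜ, sign i t • T i (ξ (insert i t)) := by
  simp [boundary]

/-- `∂ (ξ ⊗ e_{i_1} ∧ ⋯ ∧ e_{i_k}) = ∑_j (-1)^(j+1) T_{i_j} ξ ⊗ e_{i_1} ∧ ⋯ ê_{i_j} ⋯ ∧ e_{i_k}`. -/
theorem boundary_tensor (T : Fin d → H →L[ℂ] H) (ξ : H) (s : Finset (Fin d)) :
    boundary T (tensor ξ s) = ∑ i ∈ s, sign i s • tensor (T i ξ) (s.erase i) := by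
  ext t
  rw [boundary_apply]
  simp only [tensor, WithLp.ofLp_sum, Finset.sum_apply, PiLp.smul_apply]
  have h1 (r u : Finset (Fin d)) (η : H) :
      (PiLp.single 2 r η : Koszul d H) u = if u = r then η else 0 := by
    by_cases h : u = r
    · subst h; simp
    · simp [h]
  simp only [h1, apply_ite (T _), map_zero, smul_ite, smul_zero]
  rw [← Finset.sum_filter, ← Finset.sum_filter]
  have hset : (tᶜ.filter fun i => insert i t = s) = s.filter fun i => t = s.erase i := by
    ext i
    simp only [Finset.mem_filter, Finset.mem_compl]
    constructor
    · rintro ⟨hi, rfl⟩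
      exact ⟨Finset.mem_insert_self i t, (Finset.erase_insert hi).symm⟩
    · rintro ⟨hi, rfl⟩
      exact ⟨Finset.notMem_erase i s, Finset.insert_erase hi⟩
  rw [hset]
  refine Finset.sum_congr rfl fun i hi => ?_
  obtain ⟨_, rfl⟩ := Finset.mem_filter.mp hi
  have h2 : sign i (s.erase i) = sign i s := by
    unfold sign
    rw [Finset.filter_erase, Finset.erase_eq_of_notMem (by simp)]
  rw [h2]

/-- `E_k = H ⊗ ⋀^k ℂ^d`, the part of `H ⊗ ⋀ ℂ^d` of degree `k` (trivial unless `0 ≤ k ≤ d`). -/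
def E (d : ℕ) (H : Type*) [NormedAddCommGroup H] [InnerProductSpace ℂ H] (k : ℤ) :
    Submodule ℂ (Koszul d H) where
  carrier := {ξ | ∀ s : Finset (Fin d), (s.card : ℤ) ≠ k → ξ s = 0}
  add_mem' hξ hη s hs := by simp [hξ s hs, hη s hs]
  zero_mem' s _ := rfl
  smul_mem' c ξ hξ s hs := by simp [hξ s hs]

lemma boundary_mapsTo (T : Fin d → H →L[ℂ] H) {k l : ℤ} (h : l + 1 = k) :
    Set.MapsTo (boundary T) (E d H k) (E d H l) := by
  intro ξ hξ t ht
  rw [boundary_apply]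
  refine Finset.sum_eq_zero fun i hi => ?_
  rw [hξ, map_zero, smul_zero]
  rw [Finset.card_insert_of_notMem (Finset.mem_compl.mp hi)]
  push_cast
  omega

/-- The Koszul differential `∂_k : E_k → E_l`, where `l = k - 1`. -/
def koszulD (T : Fin d → H →L[ℂ] H) (k l : ℤ) (h : l + 1 = k) : E d H k →L[ℂ] E d H l :=
  (boundary T).restrict (boundary_mapsTo T h)

/-- The cycles `ker ∂_k`. -/
def cycles (T : Fin d → H →L[ℂ] H) (k : ℤ) : Submodule ℂ (E d H k) :=
  (koszulD T k (k - 1) (sub_add_cancel k 1)).ker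

/-- The boundaries `im ∂_{k+1}`. -/
def boundaries (T : Fin d → H →L[ℂ] H) (k : ℤ) : Submodule ℂ (E d H k) :=
  (koszulD T (k + 1) k rfl).range

/-- The Koszul homology `ker ∂_k / im ∂_{k+1}`. -/
abbrev KoszulHomology (T : Fin d → H →L[ℂ] H) (k : ℤ) : Type _ :=
  cycles T k ⧸ (boundaries T k).submoduleOf (cycles T k)

/-- The Dirac operator `∂ + ∂^*`. -/
def dirac [CompleteSpace H] (T : Fin d → H →L[ℂ] H) : Koszul d H →L[ℂ] Koszul d H :=
  boundary T + ContinuousLinearMap.adjoint (boundary T)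

/-- A `d`-tuple of mutually commuting bounded operators on a Hilbert space is Fredholm if its
Dirac operator is a Fredholm operator. -/
structure IsFredholmTuple [CompleteSpace H] (T : Fin d → H →L[ℂ] H) : Prop where
  commute : ∀ i j, Commute (T i) (T j)
  isFredholm_dirac : (dirac T).IsFredholm

/-- The augmentation `∂_{1/2} : E_0 → ℂ`, `ξ ↦ ξ(0)`, where `E_0 = H_d^2 ⊗ ⋀^0 ℂ^d` is identified
with `H_d^2` through `ξ ⊗ e_∅ ↦ ξ`. -/
def augmentation (d : ℕ) : E d (H2 d) 0 →L[ℂ] ℂ :=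
  (evalAt (origin d)).comp
    ((PiLp.proj 2 (fun _ : Finset (Fin d) => H2 d) ∅).comp (E d (H2 d) 0).subtypeL)

end DShift

end

/-! The theorem reduces to one estimate. Let `D = ∂ + ∂^*` and let `vac` be the orthogonal
projection onto the line of `1 ⊗ e_∅`. Then `‖ξ‖² / 2 ≤ ‖D ξ‖² + ‖vac ξ‖²` (`half_norm_sq_le`).

The estimate comes from a commutation relation. On homogeneous polynomials of degree `n`, `(n + 1)
S_i^* S_j = δ_ij + n S_j S_i^*`. If `ℓ = ∑ c_k z_k`, then `S_i^* ℓ^(n+1) = c_i ℓ^n`; differentiating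
this in the direction `z_j` gives the relation on `ℓ^n`. That suffices, since the degree `n`
component of each kernel function is such a power and kernel functions span a dense subspace.
Combined with the canonical anticommutation relations, it yields `(n + 1) ∂^*∂ + n ∂∂^* = N + n` in
degree `n`, where `N` is the number operator on `⋀ ℂ^d` (`laplace_shift`). This bounds `∂^*∂ + ∂∂^*`
below by `1/2` in each degree, away from `1 ⊗ e_∅`, and Parseval's identity adds up the degrees.

Since `D` and `vac` are self-adjoint with product zero, `D + vac` is invertible
(`isUnit_dirac_add_vac`). So `D` is Fredholm, being a finite-rank perturbation of an invertible
operator. Solving `(D + vac) η = ξ` for a cycle `ξ` with `vac ξ = 0` forces `vac η = 0` and `∂^* η =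
0`, hence `ξ = ∂ η` (`exists_boundary_eq`). The only obstruction is thus the value at `0` of the
coefficient of `e_∅`, which is the augmentation. -/

noncomputable section

namespace DShift

open ContinuousLinearMap Filter Topology

/-! ### Kernel functions as joint eigenvectors of the adjoint shifts -/

/-- The kernel function `k_w` of `H_d^2`. -/
def ker {d : ℕ} (w : Ball d) : H2 d := RKHS.kerFun (H2 d) w 1

lemma ker_apply {d : ℕ} (w z : Ball d) : ker w z = scalarKernel z w := kerFun_apply z w

lemma ker_inner {d : ℕ} (w : Ball d) (f : H2 d) : inner ℂ (ker w) f = f w := by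
  simp [ker]

lemma ext_of_apply_ker {d : ℕ} {F : Type*} [AddCommGroup F] [Module ℂ F] [TopologicalSpace F]
    [T2Space F] {A B : H2 d →L[ℂ] F} (h : ∀ w, A (ker w) = B (ker w)) : A = B := by
  refine DFunLike.coe_injective ((denseRange_kerComb d).equalizer A.continuous B.continuous ?_)
  funext f
  simp only [Function.comp_apply, kerComb, Finsupp.linearCombination_apply, Finsupp.sum, map_sum,
    map_smul]
  exact Finset.sum_congr rfl fun w _ => by rw [← ker, h w]

lemma shift_commute (d : ℕ) (i j : Fin d) : Commute (shift d i) (shift d j) := by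
  refine ContinuousLinearMap.ext fun f => RKHS.ext (𝕜 := ℂ) fun z => ?_
  rw [mul_apply_eq_comp, mul_apply_eq_comp]
  simp only [shift_apply]
  ring

lemma star_shift_ker {d : ℕ} (i : Fin d) (w : Ball d) :
    star (shift d i) (ker w) = conj (w.1 i) • ker w := by
  refine ext_inner_right ℂ fun f => ?_
  rw [star_eq_adjoint, adjoint_inner_left, ker_inner, shift_apply, inner_smul_left, ker_inner]
  simp

/-- The constant function `1`. -/
def one (d : ℕ) : H2 d := ker (origin d)

@[simp] lemma one_apply {d : ℕ} (z : Ball d) : one d z = 1 := by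
  simp [one, ker_apply, scalarKernel, origin]

lemma one_inner {d : ℕ} (f : H2 d) : inner ℂ (one d) f = f (origin d) := ker_inner _ f

lemma star_shift_one {d : ℕ} (i : Fin d) : star (shift d i) (one d) = 0 := by
  rw [one, star_shift_ker]
  simp [origin]

/-! ### Linear combinations of the shifts -/

/-- Multiplication by the linear form `z ↦ ∑ c_i z_i`. -/
def linMul {d : ℕ} (c : Fin d → ℂ) : H2 d →L[ℂ] H2 d := ∑ i, c i • shift d i

lemma linMul_apply {d : ℕ} (c : Fin d → ℂ) (f : H2 d) :
    linMul c f = ∑ i, c i • shift d i f := by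
  simp [linMul, sum_apply]

lemma linMul_apply_apply {d : ℕ} (c : Fin d → ℂ) (f : H2 d) (z : Ball d) :
    linMul c f z = (∑ i, c i * z.1 i) * f z := by
  rw [linMul_apply, ← evalAt_apply, map_sum, Finset.sum_mul]
  exact Finset.sum_congr rfl fun i _ => by simp [shift_apply, mul_assoc]

lemma linMul_pow_apply_apply {d : ℕ} (c : Fin d → ℂ) (n : ℕ) (f : H2 d) (z : Ball d) :
    (linMul c ^ n) f z = (∑ i, c i * z.1 i) ^ n * f z := by
  induction n with
  | zero => simp
  | succ n ih => rw [pow_succ', mul_apply_eq_comp, linMul_apply_apply, ih]; ring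

/-- This is `k_w = 1 + ⟨·, w⟩ k_w`, the hypothesis on `c` making `⟨·, w⟩` equal to `s` times the
linear form. -/
lemma linMul_ker {d : ℕ} {c : Fin d → ℂ} {s : ℂ} {w : Ball d} (h : ∀ i, conj (w.1 i) = s * c i) :
    s • linMul c (ker w) = ker w - one d := by
  refine RKHS.ext (𝕜 := ℂ) fun z => ?_
  rw [← evalAt_apply, ← evalAt_apply, map_smul, map_sub]
  simp only [evalAt_apply, linMul_apply_apply, one_apply, ker_apply]
  conv_rhs => rw [scalarKernel_eq]
  rw [← Finset.sum_mul]
  simp only [h, smul_eq_mul, ← mul_assoc, Finset.mul_sum]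
  rw [add_sub_cancel_left]
  congr 1
  exact Finset.sum_congr rfl fun i _ => by ring

lemma linMul_pow_ker {d : ℕ} {c : Fin d → ℂ} {s : ℂ} {w : Ball d} (h : ∀ i, conj (w.1 i) = s * c i)
    (n : ℕ) : s • (linMul c ^ (n + 1)) (ker w) = (linMul c ^ n) (ker w) - (linMul c ^ n) (one d) := by
  rw [pow_succ, mul_apply_eq_comp, ← map_smul, linMul_ker h, map_sub]

lemma tendsto_ker {d : ℕ} {ι : Type*} {l : Filter ι} {w : ι → Ball d}
    (h : Tendsto (fun t => (w t).1) l (𝓝 0)) : Tendsto (fun t => ker (w t)) l (𝓝 (one d)) := by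
  rw [tendsto_iff_norm_sub_tendsto_zero]
  -- The reproducing property turns the distance to `1` into a value of the kernel on the diagonal.
  have e (x : Ball d) : ‖ker x - one d‖ ^ 2 = (scalarKernel x x).re - 1 := by
    have h1 : (inner ℂ (ker x - one d) (ker x - one d) : ℂ) = scalarKernel x x - 1 := by
      rw [inner_sub_left, ker_inner, one_inner, ← evalAt_apply, ← evalAt_apply, map_sub, map_sub]
      simp [ker_apply, scalarKernel, origin]
    have h2 := congrArg Complex.re h1
    rw [Complex.sub_re, Complex.one_re] at h2
    rw [← h2]
    exact (inner_self_eq_norm_sq (𝕜 := ℂ) _).symm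
  have h2 : Tendsto (fun t => ‖ker (w t) - one d‖ ^ 2) l (𝓝 0) := by
    simp only [e, scalarKernel]
    have h3 : Tendsto (fun t => inner ℂ (w t).1 (w t).1) l (𝓝 (0 : ℂ)) := by
      simpa using h.inner (𝕜 := ℂ) h
    have h4 : Tendsto (fun t => (1 / (1 - inner ℂ (w t).1 (w t).1) : ℂ)) l (𝓝 1) := by
      have h5 := (tendsto_const_nhds (x := (1 : ℂ)) (f := l)).sub h3
      rw [sub_zero] at h5
      simpa only [one_div, inv_one] using h5.inv₀ one_ne_zero
    simpa [Function.comp_def] using ((Complex.continuous_re.tendsto _).comp h4).sub_const 1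
  simpa using h2.sqrt

/-! ### Adjoint shifts on powers of linear forms -/

lemma exists_ball_smul {d : ℕ} (c : Fin d → ℂ) : ∃ w : ℕ → Ball d, ∃ s : ℕ → ℂ,
    (∀ n, s n ≠ 0) ∧ Tendsto (fun n => (w n).1) atTop (𝓝 0) ∧
      ∀ n i, conj ((w n).1 i) = s n * c i := by
  let v : EuclideanSpace ℂ (Fin d) := WithLp.toLp 2 fun i => conj (c i)
  -- The extra `1` keeps `r` positive when `c = 0` and makes `‖v‖ / r < 1`.
  let r : ℝ := ‖v‖ + 1
  have hr : 0 < r := by positivity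
  let s : ℕ → ℝ := fun n => r⁻¹ * (1 / ((n : ℝ) + 1))
  have hs (n : ℕ) : 0 < s n := by positivity
  have hb (n : ℕ) : ((s n : ℂ) • v) ∈ Metric.ball (0 : EuclideanSpace ℂ (Fin d)) 1 := by
    rw [mem_ball_zero_iff, norm_smul, Complex.norm_real, Real.norm_of_nonneg (hs n).le]
    have h1 : (1 / ((n : ℝ) + 1)) ≤ 1 := by
      rw [div_le_one (by positivity)]; linarith [Nat.cast_nonneg (α := ℝ) n]
    calc s n * ‖v‖ ≤ r⁻¹ * 1 * ‖v‖ := by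
          exact mul_le_mul_of_nonneg_right (mul_le_mul_of_nonneg_left h1 (by positivity)) (norm_nonneg v)
      _ < 1 := by
          rw [mul_one, inv_mul_lt_iff₀ hr]; simp [r]
  have ht : Tendsto s atTop (𝓝 0) := by
    simpa [s] using (tendsto_one_div_add_atTop_nhds_zero_nat (𝕜 := ℝ)).const_mul r⁻¹
  refine ⟨fun n => ⟨_, hb n⟩, fun n => s n, fun n => Complex.ofReal_ne_zero.mpr (hs n).ne', ?_, fun n i => ?_⟩
  · have : Tendsto (fun n => (s n : ℂ)) atTop (𝓝 0) := by
      simpa [Function.comp_def] using (Complex.continuous_ofReal.tendsto 0).comp ht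
    simpa using this.smul_const v
  · simp [v]

/-- After multiplication by `s`, the identity `s ℓ k_w = k_w - 1` lowers the exponent by one, at the
cost of a term in `ℓ^n · 1` that `ih` handles. -/
lemma star_shift_linMul_pow_ker {d : ℕ} {c : Fin d → ℂ} {s : ℂ} (hs : s ≠ 0) {w : Ball d}
    (h : ∀ i, conj (w.1 i) = s * c i) (i : Fin d) (n : ℕ)
    (ih : ∀ m < n, star (shift d i) ((linMul c ^ (m + 1)) (one d)) = c i • (linMul c ^ m) (one d)) :
    star (shift d i) ((linMul c ^ (n + 1)) (ker w)) = c i • (linMul c ^ n) (ker w) := by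
  have hs' := smul_right_injective (H2 d) hs
  induction n with
  | zero =>
    apply hs'
    simp only [zero_add, pow_one, pow_zero, one_apply_eq_self]
    rw [← map_smul, linMul_ker h, map_sub, star_shift_one, sub_zero, star_shift_ker, h, mul_smul]
  | succ n ihn =>
    apply hs'
    change s • _ = s • _
    rw [← map_smul, linMul_pow_ker h, map_sub, ihn fun m hm => ih m (by omega), ih n (by omega),
      smul_comm s (c i), linMul_pow_ker h, smul_sub]

/-- Limit of the identity for `k_w` as `w → 0` along the direction conjugate to `c`, where `k_w →
1`. -/
lemma star_shift_linMul_pow_one {d : ℕ} (c : Fin d → ℂ) (i : Fin d) (n : ℕ) :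
    star (shift d i) ((linMul c ^ (n + 1)) (one d)) = c i • (linMul c ^ n) (one d) := by
  induction n using Nat.strong_induction_on with
  | _ n ih =>
    obtain ⟨w, s, hs, hw, h⟩ := exists_ball_smul c
    have ht := tendsto_ker hw
    have h1 := ((star (shift d i)).continuous.tendsto _).comp
      (((linMul c ^ (n + 1)).continuous.tendsto _).comp ht)
    have h2 := (((linMul c ^ n).continuous.tendsto _).comp ht).const_smul (c i)
    refine tendsto_nhds_unique h1 (h2.congr fun m => ?_)
    exact (star_shift_linMul_pow_ker (hs m) (h m) i n ih).symm

lemma commute_linMul_shift {d : ℕ} (c : Fin d → ℂ) (j : Fin d) :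
    Commute (linMul c) (shift d j) :=
  Commute.sum_left _ _ _ fun i _ => (shift_commute d i j).smul_left _

lemma hasDerivAt_pow_of_commute {A : Type*} [NormedRing A] [NormedAlgebra ℂ A] {S T : A}
    (h : Commute T S) (n : ℕ) :
    HasDerivAt (fun t : ℂ => (T + t • S) ^ n) ((n : ℂ) • (T ^ (n - 1) * S)) 0 := by
  induction n with
  | zero => simpa using hasDerivAt_const (0 : ℂ) (1 : A)
  | succ n ih =>
    have h1 : HasDerivAt (fun t : ℂ => T + t • S) S 0 := by
      simpa using ((hasDerivAt_id (0 : ℂ)).smul_const S).const_add T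
    have h2 := ih.mul h1
    simp only [zero_smul, add_zero] at h2
    convert h2 using 1
    · ext t; simp [pow_succ]
    · cases n with
      | zero => simp
      | succ m =>
        have : S * T = T * S := h.eq.symm
        simp only [Nat.add_sub_cancel, smul_mul_assoc, mul_assoc, this]
        rw [← mul_assoc, ← pow_succ]
        push_cast
        rw [add_smul _ (1 : ℂ), one_smul]

/-- Replace `ℓ` by `ℓ + t z_j` in `S_i^* ℓ^(n+1) = c_i ℓ^n` and differentiate at `t = 0`. -/
lemma star_shift_shift_linMul_pow_one {d : ℕ} (c : Fin d → ℂ) (i j : Fin d) (n : ℕ) :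
    ((n : ℂ) + 1) • star (shift d i) (shift d j ((linMul c ^ n) (one d))) =
      (if i = j then (linMul c ^ n) (one d) else 0) +
        (n : ℂ) • shift d j (star (shift d i) ((linMul c ^ n) (one d))) := by
  have hadd (t : ℂ) : linMul (fun k => c k + t * if k = j then 1 else 0) =
      linMul c + t • shift d j := by
    simp [linMul, add_smul, Finset.sum_add_distrib]
  have key (m : ℕ) : HasDerivAt (fun t : ℂ => ((linMul c + t • shift d j) ^ m) (one d))
      (((m : ℂ) • (linMul c ^ (m - 1) * shift d j)) (one d)) 0 :=
    (ContinuousLinearMap.apply ℂ (H2 d) (one d)).hasFDerivAt.comp_hasDerivAt _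
      (hasDerivAt_pow_of_commute (commute_linMul_shift c j) m)
  have hc : HasDerivAt (fun t : ℂ => c i + t * if i = j then 1 else 0) (if i = j then 1 else 0) 0 := by
    simpa using ((hasDerivAt_id (0 : ℂ)).mul_const (if i = j then (1 : ℂ) else 0)).const_add (c i)
  have hl := (star (shift d i)).hasFDerivAt.comp_hasDerivAt (0 : ℂ) (key (n + 1))
  have hr := hc.smul (key n)
  have e : (⇑(star (shift d i)) ∘ fun t : ℂ => ((linMul c + t • shift d j) ^ (n + 1)) (one d)) =
      fun t : ℂ => (c i + t * if i = j then 1 else 0) • ((linMul c + t • shift d j) ^ n) (one d) := by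
    funext t
    rw [Function.comp_apply, ← hadd, star_shift_linMul_pow_one]
  rw [e] at hl
  have hu := hl.unique hr
  simp only [zero_mul, add_zero, zero_smul, Nat.add_sub_cancel] at hu
  simp only [smul_apply, map_smul, ((commute_linMul_shift c j).pow_left _).eq, mul_apply_eq_comp] at hu
  rw [Nat.cast_succ] at hu
  rw [hu, add_comm, ite_smul, one_smul, zero_smul]
  congr 1
  -- The product rule leaves `n c_i z_j ℓ^(n-1)`. It vanishes for `n = 0`; otherwise `c_i ℓ^(n-1) =
  -- S_i^* ℓ^n`.
  cases n with
  | zero => simp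
  | succ m =>
    rw [star_shift_linMul_pow_one, map_smul, smul_comm, Nat.add_sub_cancel]

/-! ### The homogeneous components -/

/-- The projection of `H_d^2` onto the functions that vanish to order `n` at the origin. -/
def tailProj (d : ℕ) : ℕ → H2 d →L[ℂ] H2 d
  | 0 => 1
  | n + 1 => ∑ i, shift d i * tailProj d n * star (shift d i)

/-- The projection of `H_d^2` onto the homogeneous polynomials of degree `n`. -/
def homProj (d : ℕ) (n : ℕ) : H2 d →L[ℂ] H2 d := tailProj d n - tailProj d (n + 1)

lemma homProj_succ (d n : ℕ) :
    homProj d (n + 1) = ∑ i, shift d i * homProj d n * star (shift d i) := by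
  simp only [homProj, mul_sub, sub_mul, Finset.sum_sub_distrib]
  rfl

lemma star_tailProj (d n : ℕ) : star (tailProj d n) = tailProj d n := by
  induction n with
  | zero => simp [tailProj]
  | succ n ih => simp [tailProj, ih, mul_assoc]

lemma star_homProj (d n : ℕ) : star (homProj d n) = homProj d n := by
  simp [homProj, star_tailProj]

lemma tailProj_ker {d : ℕ} (n : ℕ) (w : Ball d) :
    tailProj d n (ker w) = (linMul (fun i => conj (w.1 i)) ^ n) (ker w) := by
  induction n with
  | zero => simp [tailProj]
  | succ n ih =>
    rw [tailProj, pow_succ', mul_apply_eq_comp, linMul_apply, sum_apply]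
    exact Finset.sum_congr rfl fun i _ => by
      rw [mul_apply_eq_comp, mul_apply_eq_comp, star_shift_ker, map_smul, map_smul, ih]

/-- The difference of consecutive tails is the degree `n` term `⟨·, w⟩^n` of the geometric series of
`k_w`. -/
lemma homProj_ker {d : ℕ} (n : ℕ) (w : Ball d) :
    homProj d n (ker w) = (linMul (fun i => conj (w.1 i)) ^ n) (one d) := by
  have h := linMul_pow_ker (c := fun i => conj (w.1 i)) (s := 1) (w := w) (by simp) n
  rw [one_smul] at h
  rw [homProj, sub_apply, tailProj_ker, tailProj_ker, h, sub_sub_cancel]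

lemma homProj_zero_apply {d : ℕ} (f : H2 d) : homProj d 0 f = f (origin d) • one d := by
  have : homProj d 0 = (evalAt (origin d)).smulRight (one d) := by
    refine ext_of_apply_ker fun w => ?_
    rw [homProj_ker]
    simp [ker_apply, scalarKernel, origin]
  rw [this]
  simp

/-- Euler's identity in disguise: `∑ S_i S_i^* ℓ^(n+1) = (∑ c_i z_i) ℓ^n`. -/
lemma tailProj_linMul_pow_one {d : ℕ} (c : Fin d → ℂ) (n : ℕ) :
    tailProj d n ((linMul c ^ n) (one d)) = (linMul c ^ n) (one d) := by
  induction n with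
  | zero => simp [tailProj]
  | succ n ih =>
    rw [tailProj, sum_apply]
    simp only [mul_apply_eq_comp, star_shift_linMul_pow_one, map_smul, ih]
    rw [pow_succ', mul_apply_eq_comp, linMul_apply]

lemma tailProj_succ_linMul_pow_one {d : ℕ} (c : Fin d → ℂ) (n : ℕ) :
    tailProj d (n + 1) ((linMul c ^ n) (one d)) = 0 := by
  induction n with
  | zero => simp [tailProj, sum_apply, star_shift_one]
  | succ n ih =>
    rw [tailProj, sum_apply]
    simp only [mul_apply_eq_comp, star_shift_linMul_pow_one, map_smul, ih]
    simp

lemma tailProj_mul_homProj (d n : ℕ) : tailProj d n * homProj d n = homProj d n :=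
  ext_of_apply_ker fun w => by
    rw [mul_apply_eq_comp, homProj_ker, tailProj_linMul_pow_one]

lemma tailProj_succ_mul_homProj (d n : ℕ) : tailProj d (n + 1) * homProj d n = 0 :=
  ext_of_apply_ker fun w => by
    rw [mul_apply_eq_comp, homProj_ker, tailProj_succ_linMul_pow_one, zero_apply]

lemma homProj_mul_self (d n : ℕ) : homProj d n * homProj d n = homProj d n := by
  conv_lhs => enter [1]; rw [homProj]
  rw [sub_mul, tailProj_mul_homProj, tailProj_succ_mul_homProj, sub_zero]

lemma homProj_mul_tailProj (d n : ℕ) : homProj d n * tailProj d n = homProj d n := by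
  have := congrArg star (tailProj_mul_homProj d n)
  rwa [star_mul, star_homProj, star_tailProj] at this

lemma tailProj_mul_self (d n : ℕ) : tailProj d n * tailProj d n = tailProj d n := by
  induction n with
  | zero => simp [tailProj]
  | succ n ih =>
    have : tailProj d (n + 1) = tailProj d n - homProj d n := by simp [homProj]
    rw [this, sub_mul, mul_sub, mul_sub, ih, tailProj_mul_homProj, homProj_mul_tailProj,
      homProj_mul_self]
    simp

lemma inner_apply_self_of_proj {H : Type*} [NormedAddCommGroup H] [InnerProductSpace ℂ H]
    [CompleteSpace H] {p : H →L[ℂ] H} (h1 : star p = p) (h2 : p * p = p) (f : H) :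
    (inner ℂ f (p f) : ℂ) = (‖p f‖ ^ 2 : ℝ) := by
  conv_lhs => rw [← h2, mul_apply_eq_comp, ← adjoint_inner_left, ← star_eq_adjoint, h1]
  rw [inner_self_eq_norm_sq_to_K]
  norm_cast

lemma norm_apply_le_of_proj {H : Type*} [NormedAddCommGroup H] [InnerProductSpace ℂ H]
    [CompleteSpace H] {p : H →L[ℂ] H} (h1 : star p = p) (h2 : p * p = p) (f : H) :
    ‖p f‖ ≤ ‖f‖ := by
  have h := norm_inner_le_norm (𝕜 := ℂ) f (p f)
  rw [inner_apply_self_of_proj h1 h2, Complex.norm_real, Real.norm_of_nonneg (by positivity), sq] at h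
  by_cases h0 : ‖p f‖ = 0
  · rw [h0]; positivity
  · exact le_of_mul_le_mul_right h (lt_of_le_of_ne (norm_nonneg _) (Ne.symm h0))

lemma tendsto_tailProj_ker {d : ℕ} (w : Ball d) :
    Tendsto (fun n => tailProj d n (ker w)) atTop (𝓝 0) := by
  rw [tendsto_zero_iff_norm_tendsto_zero]
  -- Evaluating `⟨·, w⟩^n k_w` at `w` gives `‖w‖^(2n) k(w, w)`, which decays geometrically.
  have e (n : ℕ) : ((‖tailProj d n (ker w)‖ ^ 2 : ℝ) : ℂ) =
      inner ℂ w.1 w.1 ^ n * scalarKernel w w := by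
    rw [← inner_apply_self_of_proj (star_tailProj d n) (tailProj_mul_self d n), ker_inner,
      tailProj_ker, linMul_pow_apply_apply, ker_apply, inner_eq]
    simp only [mul_comm]
  have h : Tendsto (fun n => ((‖tailProj d n (ker w)‖ ^ 2 : ℝ) : ℂ)) atTop (𝓝 0) := by
    simp only [e]
    simpa using (tendsto_pow_atTop_nhds_zero_of_norm_lt_one (norm_inner_lt w w)).mul_const
      (scalarKernel w w)
  have h2 : Tendsto (fun n => ‖tailProj d n (ker w)‖ ^ 2) atTop (𝓝 0) := by
    simpa only [Function.comp_def, Complex.ofReal_re, Complex.zero_re] using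
      (Complex.continuous_re.tendsto _).comp h
  simpa using h2.sqrt

lemma tendsto_tailProj {d : ℕ} (f : H2 d) :
    Tendsto (fun n => tailProj d n f) atTop (𝓝 0) := by
  have hk (g : Ball d →₀ ℂ) : Tendsto (fun n => tailProj d n (kerComb d g)) atTop (𝓝 0) := by
    simp only [kerComb, Finsupp.linearCombination_apply, Finsupp.sum, map_sum, map_smul]
    have := tendsto_finsetSum g.support fun w _ => (tendsto_tailProj_ker w).const_smul (g w)
    simpa [ker] using this
  rw [Metric.tendsto_atTop]
  intro ε hε
  obtain ⟨g, hg⟩ := (denseRange_kerComb d).exists_dist_lt f (half_pos hε)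
  obtain ⟨N, hN⟩ := Metric.tendsto_atTop.mp (hk g) (ε / 2) (half_pos hε)
  refine ⟨N, fun n hn => ?_⟩
  have h1 := hN n hn
  rw [dist_zero_right] at h1 ⊢
  rw [dist_eq_norm] at hg
  -- The bound `‖tailProj d n‖ ≤ 1`, uniform in `n`, passes the limit from the dense span of the
  -- kernel functions to `f`.
  have h2 := norm_apply_le_of_proj (star_tailProj d n) (tailProj_mul_self d n) (f - kerComb d g)
  rw [map_sub] at h2
  linarith [norm_le_norm_sub_add (tailProj d n f) (tailProj d n (kerComb d g))]

/-- Parseval's identity for the decomposition into homogeneous components. -/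
lemma hasSum_norm_sq_homProj {d : ℕ} (f : H2 d) :
    HasSum (fun n => ‖homProj d n f‖ ^ 2) (‖f‖ ^ 2) := by
  rw [hasSum_iff_tendsto_nat_of_nonneg fun n => sq_nonneg _]
  have e (n : ℕ) : ∑ m ∈ Finset.range n, ‖homProj d m f‖ ^ 2 =
      ‖f‖ ^ 2 - ‖tailProj d n f‖ ^ 2 := by
    induction n with
    | zero => simp [tailProj]
    | succ n ih =>
      have h1 : tailProj d n f = homProj d n f + tailProj d (n + 1) f := by simp [homProj]
      have h2 : (inner ℂ f (tailProj d n f) : ℂ) =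
          inner ℂ f (homProj d n f) + inner ℂ f (tailProj d (n + 1) f) := by
        rw [h1, inner_add_right]
      rw [inner_apply_self_of_proj (star_tailProj d _) (tailProj_mul_self d _),
        inner_apply_self_of_proj (star_tailProj d _) (tailProj_mul_self d _),
        inner_apply_self_of_proj (star_homProj d _) (homProj_mul_self d _)] at h2
      rw [Finset.sum_range_succ, ih]
      norm_cast at h2
      linarith
  simp only [e]
  simpa using ((tendsto_tailProj f).norm.pow 2).const_sub (‖f‖ ^ 2)

/-! ### Commutation relations -/

lemma homProj_mul_star_shift {d : ℕ} (i : Fin d) (n : ℕ) :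
    homProj d n * star (shift d i) = star (shift d i) * homProj d (n + 1) :=
  ext_of_apply_ker fun w => by
    rw [mul_apply_eq_comp, mul_apply_eq_comp, star_shift_ker, map_smul, homProj_ker, homProj_ker,
      star_shift_linMul_pow_one]

lemma star_shift_mul_homProj_zero {d : ℕ} (i : Fin d) : star (shift d i) * homProj d 0 = 0 :=
  ext_of_apply_ker fun w => by
    rw [mul_apply_eq_comp, homProj_ker, pow_zero, one_apply_eq_self, star_shift_one, zero_apply]

lemma homProj_succ_mul_shift {d : ℕ} (i : Fin d) (n : ℕ) :
    homProj d (n + 1) * shift d i = shift d i * homProj d n := by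
  have := congrArg star (homProj_mul_star_shift i n)
  rw [star_mul, star_mul, star_star, star_homProj, star_homProj] at this
  exact this.symm

lemma homProj_zero_mul_shift {d : ℕ} (i : Fin d) : homProj d 0 * shift d i = 0 := by
  have := congrArg star (star_shift_mul_homProj_zero i)
  rwa [star_mul, star_star, star_homProj, star_zero] at this

lemma star_shift_mul_shift_mul_homProj {d : ℕ} (i j : Fin d) (n : ℕ) :
    ((n : ℂ) + 1) • (star (shift d i) * shift d j * homProj d n) =
      (if i = j then homProj d n else 0) +
        (n : ℂ) • (shift d j * star (shift d i) * homProj d n) :=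
  ext_of_apply_ker fun w => by
    have := star_shift_shift_linMul_pow_one (fun i => conj (w.1 i)) i j n
    simp only [add_apply, smul_apply, mul_apply_eq_comp, homProj_ker]
    rw [this]
    split_ifs <;> simp [homProj_ker]

/-- `∑ S_i S_i^*` is the identity in positive degrees and zero on constants; the factor `n` covers
both cases at once. -/
lemma sum_shift_mul_star_shift_mul_homProj (d n : ℕ) :
    (n : ℂ) • ((∑ i, shift d i * star (shift d i)) * homProj d n) = (n : ℂ) • homProj d n := by
  cases n with
  | zero => simp
  | succ n =>
    congr 1
    rw [Finset.sum_mul]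
    simp only [mul_assoc, ← homProj_mul_star_shift]
    rw [homProj_succ]
    simp only [mul_assoc]

section Operators

variable {d : ℕ} {H : Type*} [NormedAddCommGroup H] [InnerProductSpace ℂ H]

/-! ### Operators on `H ⊗ ⋀ ℂ^d` -/

/-- The operator on `H ⊗ ⋀ ℂ^d` with the given coordinates. -/
def ofCoord (A : Finset (Fin d) → Koszul d H →L[ℂ] H) : Koszul d H →L[ℂ] Koszul d H :=
  (PiLp.continuousLinearEquiv 2 ℂ fun _ : Finset (Fin d) => H).symm.toContinuousLinearMap.comp
    (ContinuousLinearMap.pi A)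

@[simp] lemma ofCoord_apply (A : Finset (Fin d) → Koszul d H →L[ℂ] H) (ξ : Koszul d H)
    (s : Finset (Fin d)) : ofCoord A ξ s = A s ξ := rfl

/-- The coordinate `ξ ↦ ξ_s`. -/
abbrev coord (s : Finset (Fin d)) : Koszul d H →L[ℂ] H :=
  PiLp.proj 2 (fun _ : Finset (Fin d) => H) s

/-- The operator `X ⊗ 1`. -/
def ampl (d : ℕ) (X : H →L[ℂ] H) : Koszul d H →L[ℂ] Koszul d H :=
  ofCoord fun s => X.comp (coord s)

@[simp] lemma ampl_apply (X : H →L[ℂ] H) (ξ : Koszul d H) (s : Finset (Fin d)) :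
    ampl d X ξ s = X (ξ s) := rfl

lemma ampl_zero : ampl d (0 : H →L[ℂ] H) = 0 := rfl

lemma ampl_add (X Y : H →L[ℂ] H) : ampl d (X + Y) = ampl d X + ampl d Y := rfl

lemma ampl_smul (c : ℂ) (X : H →L[ℂ] H) : ampl d (c • X) = c • ampl d X := rfl

lemma ampl_mul (X Y : H →L[ℂ] H) : ampl d (X * Y) = ampl d X * ampl d Y := rfl

lemma ampl_sum {ι : Type*} (s : Finset ι) (X : ι → H →L[ℂ] H) :
    ampl d (∑ i ∈ s, X i) = ∑ i ∈ s, ampl d (X i) := by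
  classical
  induction s using Finset.induction_on with
  | empty => rfl
  | insert i s hi ih => rw [Finset.sum_insert hi, Finset.sum_insert hi, ampl_add, ih]

/-- The annihilation operator `1 ⊗ c_i^*`. -/
def anni (H : Type*) [NormedAddCommGroup H] [InnerProductSpace ℂ H] (i : Fin d) :
    Koszul d H →L[ℂ] Koszul d H :=
  ofCoord fun t => if i ∈ t then 0 else sign i t • coord (insert i t)

/-- The creation operator `1 ⊗ c_i`. -/
def crea (H : Type*) [NormedAddCommGroup H] [InnerProductSpace ℂ H] (i : Fin d) :
    Koszul d H →L[ℂ] Koszul d H :=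
  ofCoord fun s => if i ∈ s then sign i s • coord (s.erase i) else 0

lemma anni_apply (i : Fin d) (ξ : Koszul d H) (t : Finset (Fin d)) :
    anni H i ξ t = if i ∈ t then 0 else sign i t • ξ (insert i t) := by
  simp only [anni, ofCoord_apply]
  split_ifs <;> rfl

lemma crea_apply (i : Fin d) (ξ : Koszul d H) (s : Finset (Fin d)) :
    crea H i ξ s = if i ∈ s then sign i s • ξ (s.erase i) else 0 := by
  simp only [crea, ofCoord_apply]
  split_ifs <;> rfl

lemma sign_insert {i : Fin d} {s : Finset (Fin d)} (hi : i ∉ s) (j : Fin d) :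
    sign j (insert i s) = (if i < j then -1 else 1) * sign j s := by
  unfold sign
  rw [Finset.filter_insert]
  split_ifs with h
  · rw [Finset.card_insert_of_notMem (by simp [hi]), pow_succ']
  · rw [one_mul]

lemma sign_insert_self {i : Fin d} {s : Finset (Fin d)} (hi : i ∉ s) :
    sign i (insert i s) = sign i s := by
  simp [sign_insert hi]

lemma sign_mul_self (i : Fin d) (s : Finset (Fin d)) : sign i s * sign i s = 1 := by
  unfold sign
  rw [← mul_pow]
  simp

lemma conj_sign (i : Fin d) (s : Finset (Fin d)) : conj (sign i s) = sign i s := by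
  simp [sign]

lemma commute_ampl_anni (X : H →L[ℂ] H) (i : Fin d) : Commute (ampl d X) (anni H i) := by
  refine ContinuousLinearMap.ext fun ξ => PiLp.ext fun s => ?_
  rw [mul_apply_eq_comp, mul_apply_eq_comp, ampl_apply, anni_apply, anni_apply, ampl_apply]
  split_ifs <;> simp

lemma commute_ampl_crea (X : H →L[ℂ] H) (i : Fin d) : Commute (ampl d X) (crea H i) := by
  refine ContinuousLinearMap.ext fun ξ => PiLp.ext fun s => ?_
  rw [mul_apply_eq_comp, mul_apply_eq_comp, ampl_apply, crea_apply, crea_apply, ampl_apply]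
  split_ifs <;> simp

/-- The canonical anticommutation relations. -/
lemma crea_mul_anni_add (i j : Fin d) :
    crea H i * anni H j + anni H j * crea H i = if i = j then 1 else 0 := by
  refine ContinuousLinearMap.ext fun ξ => PiLp.ext fun s => ?_
  rw [add_apply, mul_apply_eq_comp, mul_apply_eq_comp, PiLp.add_apply, crea_apply, anni_apply,
    anni_apply, crea_apply]
  by_cases hij : i = j
  · subst hij
    by_cases hi : i ∈ s
    · obtain ⟨t, ht, rfl⟩ : ∃ t, i ∉ t ∧ insert i t = s :=
        ⟨s.erase i, Finset.notMem_erase i s, Finset.insert_erase hi⟩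
      simp [ht, sign_insert_self ht, smul_smul, sign_mul_self]
    · simp [hi, sign_insert_self hi, smul_smul, sign_mul_self]
  · simp only [hij, if_false, zero_apply, PiLp.zero_apply]
    by_cases hi : i ∈ s
    · obtain ⟨t, ht, rfl⟩ : ∃ t, i ∉ t ∧ insert i t = s :=
        ⟨s.erase i, Finset.notMem_erase i s, Finset.insert_erase hi⟩
      by_cases hj : j ∈ t
      · simp [hj, ht]
      · have h1 : i ∉ insert j t := by simp [hij, ht]
        have h2 : insert j (insert i t) = insert i (insert j t) := Finset.insert_comm _ _ _
        have h3 : j ∉ insert i t := by simp [hj, Ne.symm hij]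
        simp only [h2, Finset.mem_insert_self, if_true, Finset.erase_insert h1,
          Finset.erase_insert ht, hj, h3, if_false, sign_insert_self ht, sign_insert_self h1,
          sign_insert ht, sign_insert hj, smul_smul]
        rw [← add_smul]
        -- Exchanging `i` and `j` flips exactly one of the two signs, depending on which index is
        -- smaller, so the two terms cancel.
        rcases lt_or_gt_of_ne hij with h | h
        · simp [h, h.not_gt]
          left; ring
        · simp [h, h.not_gt]
          left; ring
    · simp [hi, hij]

lemma anni_mul_anni (i j : Fin d) : anni H i * anni H j = -(anni H j * anni H i) := by
  refine ContinuousLinearMap.ext fun ξ => PiLp.ext fun s => ?_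
  rw [neg_apply, mul_apply_eq_comp, mul_apply_eq_comp, PiLp.neg_apply, anni_apply, anni_apply,
    anni_apply, anni_apply]
  by_cases hi : i ∈ s
  · simp [hi]
  by_cases hj : j ∈ s
  · simp [hj]
  by_cases hij : i = j
  · subst hij; simp
  simp only [hi, hj, Finset.mem_insert, hij, Ne.symm hij, or_false, if_false, sign_insert hi,
    sign_insert hj, Finset.insert_comm j i s, smul_smul, ← neg_smul]
  congr 1
  rcases lt_or_gt_of_ne hij with h | h
  · simp [h, h.not_gt]; ring
  · simp [h, h.not_gt]; ring

lemma sum_crea_mul_anni_apply (ξ : Koszul d H) (s : Finset (Fin d)) :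
    (∑ i, crea H i * anni H i) ξ s = (s.card : ℂ) • ξ s := by
  rw [sum_apply, WithLp.ofLp_sum, Finset.sum_apply]
  have h (i : Fin d) : (crea H i * anni H i) ξ s = if i ∈ s then ξ s else 0 := by
    rw [mul_apply_eq_comp, crea_apply, anni_apply]
    by_cases hi : i ∈ s
    · obtain ⟨t, ht, rfl⟩ : ∃ t, i ∉ t ∧ insert i t = s :=
        ⟨s.erase i, Finset.notMem_erase i s, Finset.insert_erase hi⟩
      simp [ht, sign_insert_self ht, smul_smul, sign_mul_self]
    · simp [hi]
  simp only [h, Finset.sum_ite_mem, Finset.univ_inter, Finset.sum_const]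
  rw [Nat.cast_smul_eq_nsmul]

/-! ### The boundary operator and its adjoint -/

lemma boundary_eq_sum (T : Fin d → H →L[ℂ] H) :
    boundary T = ∑ i, ampl d (T i) * anni H i := by
  refine ContinuousLinearMap.ext fun ξ => PiLp.ext fun t => ?_
  rw [boundary_apply, sum_apply, WithLp.ofLp_sum, Finset.sum_apply]
  have h (i : Fin d) : (ampl d (T i) * anni H i) ξ t =
      if i ∈ tᶜ then sign i t • T i (ξ (insert i t)) else 0 := by
    rw [mul_apply_eq_comp, ampl_apply, anni_apply]
    by_cases hi : i ∈ t <;> simp [hi]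
  simp only [h, Finset.sum_ite_mem, Finset.univ_inter]

/-- The products `T_i T_j` are symmetric in `i, j` while the products of annihilators are
antisymmetric, so `∂²` equals its own negative. -/
lemma boundary_mul_self {T : Fin d → H →L[ℂ] H} (hT : ∀ i j, Commute (T i) (T j)) :
    boundary T * boundary T = 0 := by
  have e (i j : Fin d) : ampl d (T i) * anni H i * (ampl d (T j) * anni H j) =
      anni H i * anni H j * ampl d (T i * T j) := by
    rw [(commute_ampl_anni (T j) j).eq, (commute_ampl_anni (T i) i).eq, ampl_mul, mul_assoc,
      ← mul_assoc (ampl d (T i)), (commute_ampl_anni (T i) j).eq]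
    simp only [mul_assoc]
  have h : boundary T * boundary T = -(boundary T * boundary T) := by
    conv_lhs => rw [boundary_eq_sum, Finset.sum_mul_sum]
    conv_rhs => rw [boundary_eq_sum, Finset.sum_mul_sum, Finset.sum_comm]
    rw [← Finset.sum_neg_distrib]
    refine Finset.sum_congr rfl fun i _ => ?_
    rw [← Finset.sum_neg_distrib]
    refine Finset.sum_congr rfl fun j _ => ?_
    rw [e, e, anni_mul_anni, (hT i j).eq]
    rfl
  refine ContinuousLinearMap.ext fun ξ => ?_
  have h1 : (boundary T * boundary T) ξ = -(boundary T * boundary T) ξ := DFunLike.congr_fun h ξ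
  have h2 : (2 : ℂ) • (boundary T * boundary T) ξ = 0 := by
    rw [two_smul]
    nth_rewrite 1 [h1]
    exact neg_add_cancel _
  exact (smul_eq_zero.mp h2).resolve_left two_ne_zero

variable [CompleteSpace H]

lemma star_ampl (X : H →L[ℂ] H) : star (ampl d X) = ampl d (star X) := by
  rw [star_eq_adjoint, star_eq_adjoint, eq_comm, eq_adjoint_iff]
  intro ξ η
  simp only [PiLp.inner_apply, ampl_apply, adjoint_inner_left]

lemma star_anni (i : Fin d) : star (anni H i) = crea H i := by
  rw [star_eq_adjoint, eq_comm, eq_adjoint_iff]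
  intro ξ η
  have h1 (s : Finset (Fin d)) : inner ℂ (crea H i ξ s) (η s) =
      if i ∈ s then sign i s * inner ℂ (ξ (s.erase i)) (η s) else 0 := by
    rw [crea_apply]
    split_ifs
    · rw [inner_smul_left, conj_sign]
    · rw [inner_zero_left]
  have h2 (s : Finset (Fin d)) : inner ℂ (ξ s) (anni H i η s) =
      if i ∉ s then sign i s * inner ℂ (ξ s) (η (insert i s)) else 0 := by
    rw [anni_apply, ite_not]
    split_ifs
    · rw [inner_zero_right]
    · rw [inner_smul_right]
  simp only [PiLp.inner_apply, h1, h2]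
  rw [← Finset.sum_filter, ← Finset.sum_filter]
  refine Finset.sum_bij' (fun s _ => s.erase i) (fun t _ => insert i t) ?_ ?_ ?_ ?_ ?_
  · intro s hs; simp
  · intro t ht; simp
  · intro s hs; exact Finset.insert_erase (Finset.mem_filter.mp hs).2
  · intro t ht; exact Finset.erase_insert (Finset.mem_filter.mp ht).2
  · intro s hs
    have hi := (Finset.mem_filter.mp hs).2
    rw [Finset.insert_erase hi]
    congr 1
    conv_lhs => rw [← Finset.insert_erase hi, sign_insert_self (Finset.notMem_erase i s)]

lemma star_boundary (T : Fin d → H →L[ℂ] H) :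
    star (boundary T) = ∑ i, ampl d (star (T i)) * crea H i := by
  rw [boundary_eq_sum, star_eq_adjoint, map_sum]
  simp only [← star_eq_adjoint]
  exact Finset.sum_congr rfl fun i _ => by
    rw [star_mul, star_anni, star_ampl, (commute_ampl_crea _ _).eq]

/-- The ranges of `∂` and `∂^*` are orthogonal because `∂² = 0`. -/
lemma norm_dirac_sq {T : Fin d → H →L[ℂ] H} (hT : ∀ i j, Commute (T i) (T j)) (ξ : Koszul d H) :
    ‖dirac T ξ‖ ^ 2 = ‖boundary T ξ‖ ^ 2 + ‖star (boundary T) ξ‖ ^ 2 := by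
  rw [dirac, add_apply, star_eq_adjoint, sq, sq, sq]
  refine norm_add_sq_eq_norm_sq_add_norm_sq_of_inner_eq_zero _ _ (𝕜 := ℂ) ?_
  rw [adjoint_inner_right, ← mul_apply_eq_comp, boundary_mul_self hT, zero_apply, inner_zero_left]

end Operators

/-! ### The weighted Laplacian in a fixed polynomial degree -/

/-- The weights `n + 1` and `n` are chosen so that `hQ` turns the first product into a diagonal part
plus `n S_j S_i^*` terms. These combine with the second product into an anticommutator, which `hcar`
makes diagonal. -/
lemma laplace_identity {A ι : Type*} [Ring A] [Algebra ℂ A] [Fintype ι] [DecidableEq ι]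
    {S S' a a' : ι → A} {Q : A} {n : ℂ}
    (hSa : ∀ i j, Commute (S i) (a j)) (hSa' : ∀ i j, Commute (S i) (a' j))
    (hS'a : ∀ i j, Commute (S' i) (a j)) (hS'a' : ∀ i j, Commute (S' i) (a' j))
    (hcar : ∀ i j, a' i * a j + a j * a' i = if i = j then 1 else 0)
    (hQ : ∀ i j, (n + 1) • (S' i * S j * Q) = (if i = j then Q else 0) + n • (S j * S' i * Q))
    (hsum : n • ((∑ i, S i * S' i) * Q) = n • Q) :
    (n + 1) • ((∑ i, S' i * a' i) * (∑ j, S j * a j) * Q) +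
      n • ((∑ j, S j * a j) * (∑ i, S' i * a' i) * Q) = (∑ i, a' i * a i) * Q + n • Q := by
  have e1 (i j : ι) : S' i * a' i * (S j * a j) = a' i * a j * (S' i * S j) := by
    rw [(hS'a' i i).eq, (hSa j j).eq, mul_assoc, ← mul_assoc (S' i), (hS'a i j).eq]
    simp only [mul_assoc]
  have e2 (i j : ι) : S j * a j * (S' i * a' i) = a j * a' i * (S j * S' i) := by
    rw [(hSa j j).eq, (hS'a' i i).eq, mul_assoc, ← mul_assoc (S j), (hSa' j i).eq]
    simp only [mul_assoc]
  rw [Finset.sum_mul_sum, Finset.sum_mul_sum,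
    Finset.sum_comm (f := fun j i => S j * a j * (S' i * a' i))]
  simp only [e1, e2, Finset.sum_mul, Finset.smul_sum, ← Finset.sum_add_distrib]
  have e3 (i j : ι) : (n + 1) • (a' i * a j * (S' i * S j) * Q) +
      n • (a j * a' i * (S j * S' i) * Q) =
        (if i = j then a' i * a i * Q else 0) + (if i = j then n • (S i * S' i * Q) else 0) := by
    rw [mul_assoc (a' i * a j), mul_assoc (a j * a' i), ← mul_smul_comm, hQ,
      ← mul_smul_comm n (a j * a' i),
      mul_add, add_assoc, ← add_mul, hcar]
    split_ifs with h
    · subst h; simp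
    · simp
  simp only [e3, Finset.sum_add_distrib, Finset.sum_ite_eq, Finset.mem_univ, if_true]
  rw [← hsum, Finset.sum_mul, Finset.smul_sum]

/-! ### The Koszul complex of the `d`-shift -/

lemma norm_sq_eq_sum {d : ℕ} {H : Type*} [NormedAddCommGroup H] [InnerProductSpace ℂ H]
    (ξ : Koszul d H) : ‖ξ‖ ^ 2 = ∑ s, ‖ξ s‖ ^ 2 :=
  PiLp.norm_sq_eq_of_L2 _ ξ

lemma re_inner_star_mul_self {H : Type*} [NormedAddCommGroup H] [InnerProductSpace ℂ H]
    [CompleteSpace H] (A : H →L[ℂ] H) (f : H) :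
    (inner ℂ f ((star A * A) f) : ℂ).re = ‖A f‖ ^ 2 := by
  rw [mul_apply_eq_comp, star_eq_adjoint, adjoint_inner_right]
  exact inner_self_eq_norm_sq (𝕜 := ℂ) _

lemma laplace_shift (d n : ℕ) :
    ((n : ℂ) + 1) • (star (boundary (shift d)) * boundary (shift d) * ampl d (homProj d n)) +
      (n : ℂ) • (boundary (shift d) * star (boundary (shift d)) * ampl d (homProj d n)) =
      (∑ i, crea (H2 d) i * anni (H2 d) i) * ampl d (homProj d n) +
        (n : ℂ) • ampl d (homProj d n) := by
  rw [star_boundary, boundary_eq_sum]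
  refine laplace_identity (fun _ _ => commute_ampl_anni _ _) (fun _ _ => commute_ampl_crea _ _)
    (fun _ _ => commute_ampl_anni _ _) (fun _ _ => commute_ampl_crea _ _) crea_mul_anni_add ?_ ?_
  · intro i j
    have := congrArg (ampl d) (star_shift_mul_shift_mul_homProj i j n)
    rw [ampl_add, apply_ite (ampl d)] at this
    exact this
  · have := congrArg (ampl d) (sum_shift_mul_star_shift_mul_homProj d n)
    rw [ampl_smul, ampl_smul, ampl_mul, ampl_sum] at this
    exact this

lemma weighted_norm_boundary {d n : ℕ} {η : Koszul d (H2 d)} (h : ampl d (homProj d n) η = η) :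
    (n + 1 : ℝ) * ‖boundary (shift d) η‖ ^ 2 + n * ‖star (boundary (shift d)) η‖ ^ 2 =
      ∑ s, (s.card : ℝ) * ‖η s‖ ^ 2 + n * ‖η‖ ^ 2 := by
  have h1 := DFunLike.congr_fun (laplace_shift d n) η
  rw [add_apply, add_apply, smul_apply, smul_apply, smul_apply, mul_apply_eq_comp _ (ampl d _),
    mul_apply_eq_comp _ (ampl d _), mul_apply_eq_comp _ (ampl d _), h] at h1
  have h2 := congrArg (fun x => (inner ℂ η x : ℂ).re) h1
  simp only [inner_add_right, inner_smul_right, Complex.add_re] at h2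
  have e1 (x : ℂ) : (((n : ℂ) + 1) * x).re = (n + 1 : ℝ) * x.re := by
    rw [← Complex.re_ofReal_mul]; push_cast; rfl
  have e2 (x : ℂ) : ((n : ℂ) * x).re = (n : ℝ) * x.re := by
    rw [← Complex.re_ofReal_mul]; push_cast; rfl
  have e3 : (inner ℂ η ((boundary (shift d) * star (boundary (shift d))) η) : ℂ).re =
      ‖star (boundary (shift d)) η‖ ^ 2 := by
    rw [← re_inner_star_mul_self, star_star]
  have e4 : (inner ℂ η ((∑ i, crea (H2 d) i * anni (H2 d) i) η) : ℂ).re =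
      ∑ s, (s.card : ℝ) * ‖η s‖ ^ 2 := by
    rw [PiLp.inner_apply, Complex.re_sum]
    refine Finset.sum_congr rfl fun s _ => ?_
    rw [sum_crea_mul_anni_apply, inner_smul_right, ← Complex.ofReal_natCast, Complex.re_ofReal_mul]
    congr 1
    exact inner_self_eq_norm_sq (𝕜 := ℂ) _
  have e5 : (inner ℂ η η : ℂ).re = ‖η‖ ^ 2 := inner_self_eq_norm_sq (𝕜 := ℂ) _
  rw [e1, e2, e2, re_inner_star_mul_self, e3, e4, e5] at h2
  exact h2

/-- The projection of `H_d^2 ⊗ ⋀ ℂ^d` onto the line spanned by `1 ⊗ e_∅`. -/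
def vac (d : ℕ) : Koszul d (H2 d) →L[ℂ] Koszul d (H2 d) :=
  ofCoord fun s => if s = ∅ then (homProj d 0).comp (coord ∅) else 0

lemma vac_apply {d : ℕ} (ξ : Koszul d (H2 d)) (s : Finset (Fin d)) :
    vac d ξ s = if s = ∅ then homProj d 0 (ξ ∅) else 0 := by
  simp only [vac, ofCoord_apply]
  split_ifs <;> rfl

lemma vac_eq_tensor {d : ℕ} (ξ : Koszul d (H2 d)) :
    vac d ξ = ξ ∅ (origin d) • tensor (one d) ∅ := by
  refine PiLp.ext fun s => ?_
  rw [vac_apply, homProj_zero_apply, PiLp.smul_apply, tensor]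
  by_cases h : s = ∅
  · subst h; simp
  · simp [h]

lemma norm_vac {d : ℕ} (ξ : Koszul d (H2 d)) : ‖vac d ξ‖ ^ 2 = ‖homProj d 0 (ξ ∅)‖ ^ 2 := by
  rw [norm_sq_eq_sum, Finset.sum_eq_single ∅]
  · simp [vac_apply]
  · intro s _ hs; simp [vac_apply, hs]
  · simp

lemma star_vac (d : ℕ) : star (vac d) = vac d := by
  rw [star_eq_adjoint, eq_comm, eq_adjoint_iff]
  intro ξ η
  rw [PiLp.inner_apply, PiLp.inner_apply, Finset.sum_eq_single ∅, Finset.sum_eq_single ∅]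
  · rw [vac_apply, vac_apply, if_pos rfl, if_pos rfl]
    conv_lhs => rw [← star_homProj, star_eq_adjoint, adjoint_inner_left]
  all_goals simp +contextual [vac_apply]

lemma boundary_mul_vac (d : ℕ) : boundary (shift d) * vac d = 0 := by
  refine ContinuousLinearMap.ext fun ξ => ?_
  rw [mul_apply_eq_comp, vac_eq_tensor, map_smul, boundary_tensor]
  simp

/-- Every coefficient of a boundary is a sum of multiples of coordinate functions, so it vanishes at
the origin. -/
lemma vac_mul_boundary (d : ℕ) : vac d * boundary (shift d) = 0 := by
  refine ContinuousLinearMap.ext fun ξ => PiLp.ext fun s => ?_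
  rw [mul_apply_eq_comp, vac_apply]
  split_ifs
  · rw [boundary_apply, map_sum]
    refine Finset.sum_eq_zero fun i _ => ?_
    rw [map_smul, ← mul_apply_eq_comp, homProj_zero_mul_shift]
    simp
  · rfl

lemma star_boundary_mul_vac (d : ℕ) : star (boundary (shift d)) * vac d = 0 := by
  have := congrArg star (vac_mul_boundary d)
  rw [star_mul, star_vac] at this
  exact this.trans (map_zero adjoint)

lemma vac_mul_star_boundary (d : ℕ) : vac d * star (boundary (shift d)) = 0 := by
  have := congrArg star (boundary_mul_vac d)
  rw [star_mul, star_vac] at this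
  exact this.trans (map_zero adjoint)

lemma hasSum_norm_sq_ampl_homProj {d : ℕ} (ξ : Koszul d (H2 d)) :
    HasSum (fun n => ‖ampl d (homProj d n) ξ‖ ^ 2) (‖ξ‖ ^ 2) := by
  simp only [norm_sq_eq_sum, ampl_apply]
  exact hasSum_sum fun s _ => hasSum_norm_sq_homProj (ξ s)

lemma boundary_mul_ampl_homProj (d n : ℕ) :
    ampl d (homProj d (n + 1)) * boundary (shift d) =
      boundary (shift d) * ampl d (homProj d n) := by
  rw [boundary_eq_sum, Finset.mul_sum, Finset.sum_mul]
  refine Finset.sum_congr rfl fun i _ => ?_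
  rw [← mul_assoc, ← ampl_mul, homProj_succ_mul_shift, ampl_mul, mul_assoc, mul_assoc,
    (commute_ampl_anni _ _).eq]

lemma ampl_homProj_zero_mul_boundary (d : ℕ) :
    ampl d (homProj d 0) * boundary (shift d) = 0 := by
  rw [boundary_eq_sum, Finset.mul_sum]
  refine Finset.sum_eq_zero fun i _ => ?_
  rw [← mul_assoc, ← ampl_mul, homProj_zero_mul_shift, ampl_zero, zero_mul]

lemma hasSum_norm_sq_boundary {d : ℕ} (ξ : Koszul d (H2 d)) :
    HasSum (fun n => ‖boundary (shift d) (ampl d (homProj d n) ξ)‖ ^ 2)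
      (‖boundary (shift d) ξ‖ ^ 2) := by
  -- `∂` raises the polynomial degree by one, so the degree `0` component of `∂ ξ` is zero and may
  -- be dropped before reindexing.
  have h := (hasSum_nat_add_iff' 1).mpr (hasSum_norm_sq_ampl_homProj (boundary (shift d) ξ))
  simp only [← mul_apply_eq_comp, boundary_mul_ampl_homProj, Finset.range_one,
    Finset.sum_singleton, ampl_homProj_zero_mul_boundary] at h
  simpa using h

lemma hasSum_norm_sq_star_boundary {d : ℕ} (ξ : Koszul d (H2 d)) :
    HasSum (fun n => ‖star (boundary (shift d)) (ampl d (homProj d n) ξ)‖ ^ 2)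
      (‖star (boundary (shift d)) ξ‖ ^ 2) := by
  have e (n : ℕ) : ampl d (homProj d n) * star (boundary (shift d)) =
      star (boundary (shift d)) * ampl d (homProj d (n + 1)) := by
    have := congrArg star (boundary_mul_ampl_homProj d n)
    rw [star_mul, star_mul, star_ampl, star_ampl, star_homProj, star_homProj] at this
    exact this.symm
  have e0 : star (boundary (shift d)) * ampl d (homProj d 0) = 0 := by
    have := congrArg star (ampl_homProj_zero_mul_boundary d)
    rw [star_mul, star_ampl, star_homProj] at this
    exact this.trans (map_zero adjoint)
  -- `∂^*` lowers the polynomial degree by one and kills degree `0`, hence the opposite reindexing.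
  rw [← hasSum_nat_add_iff' 1]
  have h := hasSum_norm_sq_ampl_homProj (star (boundary (shift d)) ξ)
  simp only [← mul_apply_eq_comp, e] at h
  simp only [← mul_apply_eq_comp, Finset.range_one, Finset.sum_singleton, e0]
  simpa using h

/-! ### The lower bound for the Dirac operator -/

/-- For `n ≥ 1` the constant is `n / (n + 1) ≥ 1/2`. For `n = 0` the weighted identity reads `‖∂ η‖²
= ∑ |s| ‖η_s‖²`, which misses only `s = ∅`. -/
lemma half_norm_sq_le_of_homogeneous {d n : ℕ} {η : Koszul d (H2 d)}
    (h : ampl d (homProj d n) η = η) :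
    1 / 2 * ‖η‖ ^ 2 ≤ ‖boundary (shift d) η‖ ^ 2 + ‖star (boundary (shift d)) η‖ ^ 2 +
      if n = 0 then ‖η ∅‖ ^ 2 else 0 := by
  have key := weighted_norm_boundary h
  have hs : 0 ≤ ∑ s, (s.card : ℝ) * ‖η s‖ ^ 2 := Finset.sum_nonneg fun s _ => by positivity
  rcases Nat.eq_zero_or_pos n with rfl | hn
  · have h1 : ‖η‖ ^ 2 ≤ ∑ s, (s.card : ℝ) * ‖η s‖ ^ 2 + ‖η ∅‖ ^ 2 := by
      rw [norm_sq_eq_sum, ← Finset.add_sum_erase _ _ (Finset.mem_univ ∅), add_comm]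
      gcongr
      refine (Finset.sum_le_sum fun s hs => ?_).trans
        (Finset.sum_le_sum_of_subset_of_nonneg (Finset.subset_univ (Finset.univ.erase ∅))
          fun s _ _ => by positivity)
      have : (1 : ℝ) ≤ s.card := by
        exact_mod_cast Finset.card_pos.mpr
          (Finset.nonempty_iff_ne_empty.mpr (Finset.ne_of_mem_erase hs))
      nlinarith [sq_nonneg ‖η s‖]
    simp only [Nat.cast_zero, zero_add, one_mul, zero_mul, add_zero] at key
    rw [if_pos rfl, key]
    nlinarith [sq_nonneg ‖η‖, sq_nonneg ‖star (boundary (shift d)) η‖]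
  · rw [if_neg hn.ne', add_zero]
    have hn' : (1 : ℝ) ≤ n := by exact_mod_cast hn
    have h3 : (n + 1 : ℝ) * (1 / 2 * ‖η‖ ^ 2) ≤ (n + 1 : ℝ) *
        (‖boundary (shift d) η‖ ^ 2 + ‖star (boundary (shift d)) η‖ ^ 2) := by
      nlinarith [sq_nonneg ‖η‖, sq_nonneg ‖star (boundary (shift d)) η‖]
    exact le_of_mul_le_mul_left h3 (by positivity)

lemma half_norm_sq_le {d : ℕ} (ξ : Koszul d (H2 d)) :
    1 / 2 * ‖ξ‖ ^ 2 ≤ ‖dirac (shift d) ξ‖ ^ 2 + ‖vac d ξ‖ ^ 2 := by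
  rw [norm_dirac_sq (shift_commute d)]
  refine hasSum_le (fun n => half_norm_sq_le_of_homogeneous (n := n) ?_)
    ((hasSum_norm_sq_ampl_homProj ξ).mul_left _)
    (((hasSum_norm_sq_boundary ξ).add (hasSum_norm_sq_star_boundary ξ)).add ?_)
  · rw [← mul_apply_eq_comp, ← ampl_mul, homProj_mul_self]
  · convert hasSum_ite_eq 0 (‖vac d ξ‖ ^ 2) using 2 with n
    by_cases hn : n = 0
    · subst hn; simp [norm_vac]
    · simp [hn]

/-! ### Fredholmness and exactness -/

lemma dirac_mul_vac (d : ℕ) : dirac (shift d) * vac d = 0 := by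
  rw [dirac, ← star_eq_adjoint, add_mul, boundary_mul_vac, star_boundary_mul_vac, add_zero]

lemma vac_mul_dirac (d : ℕ) : vac d * dirac (shift d) = 0 := by
  rw [dirac, ← star_eq_adjoint, mul_add, vac_mul_boundary, vac_mul_star_boundary, add_zero]

lemma star_dirac (d : ℕ) : star (dirac (shift d)) = dirac (shift d) := by
  rw [dirac, star_eq_adjoint, map_add, adjoint_adjoint, add_comm]

/-- For the self-adjoint `A = D + vac`, the square is coercive: `⟨A² ξ, ξ⟩ = ‖A ξ‖² ≥ ‖ξ‖² / 2`.
Hence `A²`, and with it `A`, is invertible. -/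
lemma isUnit_dirac_add_vac (d : ℕ) : IsUnit (dirac (shift d) + vac d) := by
  rw [← isUnit_pow_iff two_ne_zero, sq]
  refine isUnit_of_forall_le_norm_inner_map _ (c := 1 / 2) (by norm_num) fun ξ => ?_
  have hs : star (dirac (shift d) + vac d) = dirac (shift d) + vac d := by
    rw [star_eq_adjoint, map_add, ← star_eq_adjoint, ← star_eq_adjoint, star_dirac, star_vac]
  have h1 : (inner ℂ (((dirac (shift d) + vac d) * (dirac (shift d) + vac d)) ξ) ξ : ℂ).re =
      ‖(dirac (shift d) + vac d) ξ‖ ^ 2 := by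
    have := re_inner_star_mul_self (dirac (shift d) + vac d) ξ
    rw [hs] at this
    rw [← this, ← inner_conj_symm, Complex.conj_re]
  have h2 : ‖(dirac (shift d) + vac d) ξ‖ ^ 2 = ‖dirac (shift d) ξ‖ ^ 2 + ‖vac d ξ‖ ^ 2 := by
    rw [add_apply, sq, sq, sq]
    refine norm_add_sq_eq_norm_sq_add_norm_sq_of_inner_eq_zero _ _ (𝕜 := ℂ) ?_
    rw [← adjoint_inner_right, ← star_eq_adjoint, star_dirac, ← mul_apply_eq_comp, dirac_mul_vac,
      zero_apply, inner_zero_right]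
  calc ‖ξ‖ ^ 2 * ((1 / 2 : NNReal) : ℝ) = 1 / 2 * ‖ξ‖ ^ 2 := by push_cast; ring
    _ ≤ _ := half_norm_sq_le ξ
    _ = _ := by rw [h1, h2]
    _ ≤ _ := Complex.re_le_norm _

/-- The inverse of `A + K` inverts `A` up to finite rank on both sides. -/
lemma isFredholm_of_isUnit_add {H : Type*} [NormedAddCommGroup H] [InnerProductSpace ℂ H]
    {A K : H →L[ℂ] H} (h : IsUnit (A + K)) (hK : (K : H →ₗ[ℂ] H).HasFiniteRange) :
    A.IsFredholm := by
  obtain ⟨U, hU⟩ := h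
  let v : H →L[ℂ] H := ↑U⁻¹
  have h1 (x : H) : v (A x) + v (K x) = x := by
    have : (↑U⁻¹ * ↑U : H →L[ℂ] H) x = x := by rw [Units.inv_mul, one_apply_eq_self]
    rwa [mul_apply_eq_comp, hU, add_apply, map_add] at this
  have h2 (x : H) : A (v x) + K (v x) = x := by
    have : (↑U * ↑U⁻¹ : H →L[ℂ] H) x = x := by rw [Units.mul_inv, one_apply_eq_self]
    rwa [mul_apply_eq_comp, hU, add_apply] at this
  refine IsFredholm.of_isQuasiInverse (v := v) ⟨?_, ?_⟩
  · refine LinearMap.FiniteRangeSetoid.equiv_iff_hasFiniteRange.mpr ?_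
    have e : (v : H →ₗ[ℂ] H) ∘ₗ (A : H →ₗ[ℂ] H) - LinearMap.id =
        -((v : H →ₗ[ℂ] H) ∘ₗ (K : H →ₗ[ℂ] H)) := by
      refine LinearMap.ext fun x => ?_
      change v (A x) - x = -v (K x)
      rw [sub_eq_iff_eq_add, ← sub_eq_neg_add, eq_sub_iff_add_eq, h1]
    rw [e]
    exact (hK.comp_left (v : H →ₗ[ℂ] H)).neg
  · refine LinearMap.FiniteRangeSetoid.equiv_iff_hasFiniteRange.mpr ?_
    have e : (A : H →ₗ[ℂ] H) ∘ₗ (v : H →ₗ[ℂ] H) - LinearMap.id =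
        -((K : H →ₗ[ℂ] H) ∘ₗ (v : H →ₗ[ℂ] H)) := by
      refine LinearMap.ext fun x => ?_
      change A (v x) - x = -K (v x)
      rw [sub_eq_iff_eq_add, ← sub_eq_neg_add, eq_sub_iff_add_eq, h2]
    rw [e]
    exact (hK.comp_right (v : H →ₗ[ℂ] H)).neg

lemma hasFiniteRange_vac (d : ℕ) :
    (vac d : Koszul d (H2 d) →ₗ[ℂ] Koszul d (H2 d)).HasFiniteRange := by
  let f : Koszul d (H2 d) →ₗ[ℂ] ℂ := ((evalAt (origin d)).comp (coord ∅)).toLinearMap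
  have : (vac d : Koszul d (H2 d) →ₗ[ℂ] Koszul d (H2 d)) =
      (LinearMap.toSpanSingleton ℂ _ (tensor (one d) ∅)) ∘ₗ f :=
    LinearMap.ext fun ξ => vac_eq_tensor ξ
  rw [this]
  exact LinearMap.HasFiniteRange.of_finite_dom.comp_right f

theorem isFredholmTuple_shift (d : ℕ) : IsFredholmTuple (shift d) :=
  ⟨shift_commute d, isFredholm_of_isUnit_add (isUnit_dirac_add_vac d) (hasFiniteRange_vac d)⟩

lemma exists_boundary_eq {d : ℕ} {ξ : Koszul d (H2 d)} (h : boundary (shift d) ξ = 0)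
    (hv : vac d ξ = 0) : ∃ η, boundary (shift d) η = ξ := by
  obtain ⟨η, hη⟩ := ((isUnit_iff_bijective).mp (isUnit_dirac_add_vac d)).surjective ξ
  rw [add_apply] at hη
  -- Applying `vac` to the equation kills the Dirac term and leaves `vac (vac η) = 0`.
  have h1 : vac d η = 0 := by
    have h0 := congrArg (vac d) hη
    rw [map_add, ← mul_apply_eq_comp, vac_mul_dirac, zero_apply, zero_add, hv, vac_eq_tensor,
      vac_eq_tensor] at h0
    rw [vac_eq_tensor]
    simpa [tensor] using h0
  rw [h1, add_zero, dirac, add_apply, ← star_eq_adjoint] at hη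
  -- Applying `∂` gives `∂ ∂^* η = 0`; pairing with `η` gives `‖∂^* η‖² = 0`.
  have h2 : star (boundary (shift d)) η = 0 := by
    have h0 := congrArg (boundary (shift d)) hη
    rw [map_add, ← mul_apply_eq_comp, boundary_mul_self (shift_commute d), zero_apply, zero_add,
      h, star_eq_adjoint] at h0
    rw [← norm_eq_zero, ← sq_eq_zero_iff, ← re_inner_star_mul_self, star_star, mul_apply_eq_comp,
      star_eq_adjoint, h0, inner_zero_right, Complex.zero_re]
  exact ⟨η, by rwa [h2, add_zero] at hη⟩

/-! ### Exactness and homology degree by degree -/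

/-- `∂` lowers the exterior degree by one, so only the degree `k + 1` part of a primitive matters
and the rest can be cut off. -/
lemma exists_mem_E_boundary_eq {d : ℕ} {H : Type*} [NormedAddCommGroup H] [InnerProductSpace ℂ H]
    {T : Fin d → H →L[ℂ] H} {k : ℤ} {ξ : Koszul d H} (hξ : ξ ∈ E d H k)
    (h : ∃ η, boundary T η = ξ) : ∃ η ∈ E d H (k + 1), boundary T η = ξ := by
  obtain ⟨η, rfl⟩ := h
  refine ⟨WithLp.toLp 2 fun s => if (s.card : ℤ) = k + 1 then η s else 0,
    fun s hs => if_neg hs, PiLp.ext fun t => ?_⟩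
  by_cases ht : (t.card : ℤ) = k
  · rw [boundary_apply, boundary_apply]
    refine Finset.sum_congr rfl fun i hi => ?_
    have : ((insert i t).card : ℤ) = k + 1 := by
      rw [Finset.card_insert_of_notMem (Finset.mem_compl.mp hi), ← ht]
      push_cast
      rfl
    simp only [this, if_true]
  · rw [hξ t ht, boundary_apply]
    refine Finset.sum_eq_zero fun i hi => ?_
    have : ((insert i t).card : ℤ) ≠ k + 1 := by
      rw [Finset.card_insert_of_notMem (Finset.mem_compl.mp hi)]
      push_cast
      omega
    simp only [this, if_false, map_zero, smul_zero]

lemma koszulD_coe {d : ℕ} {H : Type*} [NormedAddCommGroup H] [InnerProductSpace ℂ H]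
    (T : Fin d → H →L[ℂ] H) (k l : ℤ) (h : l + 1 = k) (ξ : E d H k) :
    (koszulD T k l h ξ : Koszul d H) = boundary T ξ := rfl

lemma koszulD_eq_zero_iff {d : ℕ} {H : Type*} [NormedAddCommGroup H] [InnerProductSpace ℂ H]
    (T : Fin d → H →L[ℂ] H) (k l : ℤ) (h : l + 1 = k) (ξ : E d H k) :
    koszulD T k l h ξ = 0 ↔ boundary T (ξ : Koszul d H) = 0 :=
  Subtype.ext_iff

theorem exact_koszulD_shift (d : ℕ) (k : ℤ) (hk : 1 ≤ k) :
    Function.Exact (koszulD (shift d) (k + 1) k rfl)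
      (koszulD (shift d) k (k - 1) (sub_add_cancel k 1)) := by
  intro ξ
  rw [koszulD_eq_zero_iff]
  constructor
  · intro h
    -- In positive exterior degree there is no `e_∅` component, so the vacuum obstruction is absent.
    have h0 : (ξ : Koszul d (H2 d)) ∅ = 0 := ξ.2 ∅ (by simp; omega)
    obtain ⟨η, hη, h1⟩ := exists_mem_E_boundary_eq ξ.2
      (exists_boundary_eq h (by rw [vac_eq_tensor, h0]; simp))
    exact ⟨⟨η, hη⟩, Subtype.ext h1⟩
  · rintro ⟨η, rfl⟩
    rw [koszulD_coe, ← mul_apply_eq_comp, boundary_mul_self (shift_commute d), zero_apply]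

lemma augmentation_apply {d : ℕ} (ξ : E d (H2 d) 0) :
    augmentation d ξ = (ξ : Koszul d (H2 d)) ∅ (origin d) := rfl

lemma boundary_eq_zero_of_mem_E_zero {d : ℕ} {H : Type*} [NormedAddCommGroup H]
    [InnerProductSpace ℂ H] (T : Fin d → H →L[ℂ] H) {ξ : Koszul d H} (hξ : ξ ∈ E d H 0) :
    boundary T ξ = 0 := by
  refine PiLp.ext fun t => ?_
  rw [boundary_apply]
  refine Finset.sum_eq_zero fun i _ => ?_
  rw [hξ (insert i t) (by
    have := Finset.card_pos.mpr (Finset.insert_nonempty i t)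
    omega), map_zero, smul_zero]

theorem exact_augmentation (d : ℕ) :
    Function.Exact (koszulD (shift d) 1 0 rfl) (augmentation d) := by
  intro ξ
  rw [augmentation_apply]
  constructor
  · intro h
    obtain ⟨η, hη, h1⟩ := exists_mem_E_boundary_eq ξ.2
      (exists_boundary_eq (boundary_eq_zero_of_mem_E_zero _ ξ.2)
        (by rw [vac_eq_tensor, h, zero_smul]))
    exact ⟨⟨η, hη⟩, Subtype.ext h1⟩
  · rintro ⟨η, rfl⟩
    rw [koszulD_coe, boundary_apply, ← evalAt_apply, map_sum]
    refine Finset.sum_eq_zero fun i _ => ?_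
    rw [map_smul, evalAt_apply, shift_apply]
    simp [origin]

theorem surjective_augmentation (d : ℕ) : Function.Surjective (augmentation d) := by
  intro c
  refine ⟨⟨tensor (c • one d) ∅, fun s hs => ?_⟩, ?_⟩
  · have : s ≠ ∅ := by rintro rfl; simp at hs
    simp [tensor, this]
  · rw [augmentation_apply]
    simp [tensor]

theorem subsingleton_koszulHomology_shift (d : ℕ) (k : ℤ) (hk : 1 ≤ k) :
    Subsingleton (KoszulHomology (shift d) k) := by
  rw [Submodule.Quotient.subsingleton_iff, Submodule.submoduleOf_eq_top]
  intro ξ hξ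
  exact (exact_koszulD_shift d k hk ξ).mp hξ

/-- Every element of `E_0` is a cycle, so the augmentation stays onto on cycles; its kernel there is
the space of boundaries. -/
theorem nonempty_koszulHomology_zero_equiv (d : ℕ) :
    Nonempty (KoszulHomology (shift d) 0 ≃ₗ[ℂ] ℂ) := by
  let f : cycles (shift d) 0 →ₗ[ℂ] ℂ := (augmentation d).toLinearMap ∘ₗ (cycles (shift d) 0).subtype
  have hf : Function.Surjective f := by
    intro c
    obtain ⟨ξ, hξ⟩ := surjective_augmentation d c
    exact ⟨⟨ξ, (koszulD_eq_zero_iff _ _ _ _ _).mpr (boundary_eq_zero_of_mem_E_zero _ ξ.2)⟩, hξ⟩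
  have hk : (boundaries (shift d) 0).submoduleOf (cycles (shift d) 0) = LinearMap.ker f := by
    ext ξ
    exact (exact_augmentation d ξ.1).symm
  exact ⟨(Submodule.quotEquivOfEq _ _ hk).trans (f.quotKerEquivOfSurjective hf)⟩

end DShift

end

theorem mainTheorem6 (d : ℕ) :
    DShift.IsFredholmTuple (DShift.shift d) ∧
    (∀ k : ℤ, 1 ≤ k →
      Function.Exact (DShift.koszulD (DShift.shift d) (k + 1) k rfl)
        (DShift.koszulD (DShift.shift d) k (k - 1) (sub_add_cancel k 1))) ∧
    Function.Exact (DShift.koszulD (DShift.shift d) 1 0 rfl) (DShift.augmentation d) ∧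
    Function.Surjective (DShift.augmentation d) ∧
    (∀ k : ℤ, 1 ≤ k → Subsingleton (DShift.KoszulHomology (DShift.shift d) k)) ∧
    Nonempty (DShift.KoszulHomology (DShift.shift d) 0 ≃ₗ[ℂ] ℂ) :=
  ⟨DShift.isFredholmTuple_shift d, DShift.exact_koszulD_shift d, DShift.exact_augmentation d,
    DShift.surjective_augmentation d, DShift.subsingleton_koszulHomology_shift d,
    DShift.nonempty_koszulHomology_zero_equiv d⟩
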